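/- **Setting.** Let $\mathcal V$ (nodes) and $\mathcal F$ (flows) be finite sets. Flow $f$ has a rate $\lambda_f>0$ and a route with node set $\mathcal V_f\subseteq\mathcal V$; node $v$ has a capacity $c_v\ge 0$ and a cost $b_v>0$; $B\ge 0$ is a budget; and $\lambda_f\le c_v$ for all $f,v$. A feasible solution of the VPCA problem (P1) is a set $\mathcal U\subseteq\mathcal V$ with $\sum_{v\in\mathcal U}b_v\le B$ and an assignment $\lambda_f^v\ge 0$ with $\sum_f\lambda_f^v\le c_v$ for $v\in\mathcal U$ and $\lambda_f^v=0$ for $v\notin\mathcal U$. It is to maximize the fully processed traffic $J_1(\mathcal U,\boldsymbol\lambda)=\sum_f\lambda_f\mathbf 1\{\sum_{v\in\mathcal V_f\cap\,\mathcal U}\lambda_f^v\ge\lambda_f\}$. Let $R_3(\mathcal U)$ be the maximum of $\sum_f\sum_{v\in\mathcal V_f\cap\,\mathcal U}\lambda_f^v$ over the assignments that satisfy the above capacity constraints for $\mathcal U$ and $\sum_{v\in\mathcal U}\lambda_f^v\le\lambda_f$ for all $f$. **Algorithm RP-MCA.** *Placement.* Obtain $\mathcal U$ by one of the following two algorithms.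 - SG (only if all costs equal some $b$): start from $\emptyset$ and repeatedly add a node with the largest increase of $R_3$ until $\lfloor B/b\rfloor$ nodes (or all nodes, if there are fewer) are selected. - EG: take a set with the largest $R_3$ among the sets of one or two nodes with cost at most $B$ and the augmentations of the sets of three nodes with cost at most $B$, where a set $\mathcal V'$ is augmented by adding repeatedly, among the nodes $u\notin\mathcal V'$ that fit in the budget, one that maximizes $(R_3(\mathcal V'\cup\{u\})-R_3(\mathcal V'))/b_u$, until no node fits. (If no node is affordable, the output is $\emptyset$.) *Allocation (MCA), Phase I.* Start from an optimal assignment for $R_3(\mathcal U)$ that is an extreme point of its feasible set and uses only nodes on the routes. Put $y_f^v=\lambda_f^v/\lambda_f$, and let $G'$ be the bipartite graph with an edge between $f$ and $v$ whenever $0<y_f^v<1$. Repeat until $G'$ has no edge: 1. If some node $v$ has exactly one incident flow $f$ in $G'$, let $r'_v$ be the traffic at $v$ of the flows $g$ with $y_g^v=1$. If $r'_v\ge\lambda_f^v$, set $y_f^v$ to $0$. Otherwise unassign the flows assigned to $v$, set $y_f^v$ to $1$, and cancel the other fractions of $f$. 2. If there is no such node, choose a node $v$ and two of its edges in $G'$,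 and a longest path from $v$ through each of them. Shift traffic along the edges of the two paths, by a common amount and with signs alternating along each path and opposite on the two edges at $v$, until some $y_f^u$ of an edge of $G'$ becomes $0$ or $1$. *Phase II.* As long as some flow $f$ that is not fully processed and whose route meets $\mathcal U$ has rate at most the total remaining capacity of $\mathcal V_f\cap\mathcal U$, assign such a flow by splitting it over $\mathcal V_f\cap\mathcal U$ within the remaining capacities. **Theorem.** RP-MCA has an approximation ratio of $\frac12(1-1/e)$ for (P1): whatever choices are made (order, ties, basic solution, paths, splittings), the algorithm can be carried out and halts, and its output $(\mathcal U,\boldsymbol\lambda)$ is feasible for (P1) and satisfies $$J_1(\mathcal U,\boldsymbol\lambda)\ \ge\ \tfrac12\,(1-1/e)\,\mathrm{OPT}(P1).$$ -/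

import Mathlib

/-- An instance of the joint VNF-node placement and capacity allocation problem: `N` is the set of
network nodes, `Fl` the set of flows, `path f` the set of nodes on the route of flow `f`. The
last field says that no flow rate exceeds the capacity of any node. -/
structure VPCA (N Fl : Type*) where
  rate : Fl → ℝ
  cap : N → ℝ
  cost : N → ℝ
  budget : ℝ
  path : Fl → Finset N
  rate_pos : ∀ f, 0 < rate f
  cap_nonneg : ∀ v, 0 ≤ cap v
  cost_pos : ∀ v, 0 < cost v
  budget_nonneg : 0 ≤ budget
  rate_le_cap : ∀ f v, rate f ≤ cap v

namespace VPCA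

/-! ### Generic nondeterministic procedures -/

/-- `t` is a possible result of repeating `step` from `s` until `done` holds. -/
def RunsTo {S : Type*} (step : S → S → Prop) (done : S → Prop) (s t : S) : Prop :=
  Relation.ReflTransGen step s t ∧ done t

/-- Every run of `step` from the given state halts after finitely many steps, and it never gets
stuck in a state that is not `done`. -/
inductive AlwaysEnds {S : Type*} (step : S → S → Prop) (done : S → Prop) : S → Prop
  | finish (s : S) (h : done s) : AlwaysEnds step done s
  | next (s : S) (h : ∃ t, step s t) (h' : ∀ t, step s t → AlwaysEnds step done t) :
      AlwaysEnds step done s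

section

variable {N Fl : Type*} [Fintype N] [DecidableEq N] [Fintype Fl] [DecidableEq Fl]

/-! ### The problem and its relaxation -/

/-- The budget constraint. -/
def Affordable (P : VPCA N Fl) (U : Finset N) : Prop :=
  ∑ v ∈ U, P.cost v ≤ P.budget

/-- The capacity constraint; `lam f v` is the (nonnegative) portion of flow `f` that is assigned
to node `v`. -/
def CapacityOK (P : VPCA N Fl) (U : Finset N) (lam : Fl → N → ℝ) : Prop :=
  (∀ f v, 0 ≤ lam f v) ∧ (∀ v ∈ U, ∑ f, lam f v ≤ P.cap v) ∧ (∀ f, ∀ v, v ∉ U → lam f v = 0)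

/-- Flow `f` is fully processed. -/
def Processed (P : VPCA N Fl) (U : Finset N) (lam : Fl → N → ℝ) (f : Fl) : Prop :=
  P.rate f ≤ ∑ v ∈ P.path f ∩ U, lam f v

open Classical in
/-- The total rate of the fully processed flows. -/
noncomputable def J1 (P : VPCA N Fl) (U : Finset N) (lam : Fl → N → ℝ) : ℝ :=
  ∑ f, if P.Processed U lam f then P.rate f else 0

/-- Feasible solutions of the VPCA problem. -/
def Feasible (P : VPCA N Fl) (U : Finset N) (lam : Fl → N → ℝ) : Prop :=
  P.Affordable U ∧ P.CapacityOK U lam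

/-- The relaxed objective: partially processed flows are counted. -/
def R1 (P : VPCA N Fl) (U : Finset N) (lam : Fl → N → ℝ) : ℝ :=
  ∑ f, ∑ v ∈ P.path f ∩ U, lam f v

/-- Feasible assignments of the relaxed allocation problem for the node set `U`. -/
def Relaxed (P : VPCA N Fl) (U : Finset N) : Set (Fl → N → ℝ) :=
  {lam | P.CapacityOK U lam ∧ ∀ f, ∑ v ∈ U, lam f v ≤ P.rate f}

/-- The optimal value of the relaxed allocation problem for the node set `U`. -/
noncomputable def R3 (P : VPCA N Fl) (U : Finset N) : ℝ :=
  sSup (P.R1 U '' P.Relaxed U)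

/-! ### Placement: Submodular Greedy (SG) and Enumeration-based Greedy (EG) -/

/-- The marginal contribution of `v` to `U` for the relaxed placement objective. -/
noncomputable def gain (P : VPCA N Fl) (U : Finset N) (v : N) : ℝ :=
  P.R3 (insert v U) - P.R3 U

/-- One iteration of SG with cardinality bound `k`; ties are broken arbitrarily. -/
def SGStep (P : VPCA N Fl) (k : ℕ) (U U' : Finset N) : Prop :=
  U.card < k ∧ ∃ v, v ∉ U ∧ (∀ w, w ∉ U → P.gain U w ≤ P.gain U v) ∧ U' = insert v U

/-- `U` is a possible output of SG, which is used for uniform node costs: `⌊B / b⌋` nodes are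
selected (all nodes, if there are fewer). -/
def SGOutput (P : VPCA N Fl) (U : Finset N) : Prop :=
  ∃ b : ℝ, (∀ v, P.cost v = b) ∧
    RunsTo (P.SGStep ⌊P.budget / b⌋₊)
      (fun S => S.card = min ⌊P.budget / b⌋₊ (Fintype.card N)) ∅ U

/-- `v` is a further node that can be added to `U` within the budget. -/
def Fits (P : VPCA N Fl) (U : Finset N) (v : N) : Prop :=
  v ∉ U ∧ P.Affordable (insert v U)

/-- One greedy augmentation: among the nodes that fit, add one that maximizes the marginal
contribution per unit of cost. -/
def AugStep (P : VPCA N Fl) (U U' : Finset N) : Prop :=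
  ∃ v, P.Fits U v ∧ (∀ w, P.Fits U w → P.gain U w / P.cost w ≤ P.gain U v / P.cost v) ∧
    U' = insert v U

/-- `U` is a possible output of EG: a candidate of largest relaxed value among the affordable sets
of one or two nodes and the greedy augmentations of the affordable sets of three nodes (one
augmentation `aug T` is computed for each such `T`). If no node is affordable, the output is
empty. -/
def EGOutput (P : VPCA N Fl) (U : Finset N) : Prop :=
  ∃ (aug : Finset N → Finset N) (cand : Set (Finset N)),
    (∀ T : Finset N, T.card = 3 → P.Affordable T →
      RunsTo P.AugStep (fun S => ¬ ∃ v, P.Fits S v) T (aug T)) ∧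
    cand = {S | P.Affordable S ∧ (S.card = 1 ∨ S.card = 2)} ∪
      aug '' {T | T.card = 3 ∧ P.Affordable T} ∧
    ((U ∈ cand ∧ ∀ S ∈ cand, P.R3 S ≤ P.R3 U) ∨ (cand = ∅ ∧ U = ∅))

/-! ### Max-flow-based capacity allocation (MCA), Phase I -/

/-- A basic optimal solution of the relaxed allocation problem, with flows assigned only to nodes
on their routes. -/
def BasicOptimal (P : VPCA N Fl) (U : Finset N) (lam : Fl → N → ℝ) : Prop :=
  lam ∈ Set.extremePoints ℝ (P.Relaxed U) ∧ P.R1 U lam = P.R3 U ∧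
    ∀ f, ∀ v, v ∉ P.path f → lam f v = 0

/-- The fraction of flow `f` that is assigned to node `v`. -/
noncomputable def frac (P : VPCA N Fl) (lam : Fl → N → ℝ) (f : Fl) (v : N) : ℝ :=
  lam f v / P.rate f

/-- `f` and `v` are joined by an edge of the bipartite graph of fractional assignments. -/
def IsEdge (P : VPCA N Fl) (lam : Fl → N → ℝ) (f : Fl) (v : N) : Prop :=
  0 < P.frac lam f v ∧ P.frac lam f v < 1

/-- The bipartite graph of fractional assignments. -/
def fracGraph (P : VPCA N Fl) (lam : Fl → N → ℝ) : SimpleGraph (Fl ⊕ N) :=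
  SimpleGraph.fromRel fun x y => ∃ f v, x = Sum.inl f ∧ y = Sum.inr v ∧ P.IsEdge lam f v

/-- The graph of fractional assignments has become empty (it has no edge). -/
def Rounded (P : VPCA N Fl) (lam : Fl → N → ℝ) : Prop :=
  ∀ f v, ¬ P.IsEdge lam f v

/-- `v` is a singleton node: its only incident flow is `f`. -/
def IsSingleton (P : VPCA N Fl) (lam : Fl → N → ℝ) (v : N) (f : Fl) : Prop :=
  P.IsEdge lam f v ∧ ∀ g, P.IsEdge lam g v → g = f

open Classical in
/-- The traffic at `v` that is contributed by flows assigned fully to `v`. -/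
noncomputable def fullLoad (P : VPCA N Fl) (lam : Fl → N → ℝ) (v : N) : ℝ :=
  ∑ f, if P.frac lam f v = 1 then lam f v else 0

/-- Rounding of a singleton node `v` with incident flow `f`: either drop the fraction of `f` at
`v`, or drop the flows assigned to `v` and assign `f` fully to `v`. -/
def Step1 (P : VPCA N Fl) (lam lam' : Fl → N → ℝ) : Prop :=
  ∃ v f, P.IsSingleton lam v f ∧
    ((lam f v ≤ P.fullLoad lam v ∧
        lam' = fun g u => if g = f ∧ u = v then 0 else lam g u) ∨
     (P.fullLoad lam v < lam f v ∧
        lam' = fun g u =>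
          if g = f then (if u = v then P.rate f else 0) else if u = v then 0 else lam g u))

/-- `p` is a longest path among those that start in the node `v` through its edge to `f`. -/
def IsLongestPath (P : VPCA N Fl) (lam : Fl → N → ℝ) (v : N) (f : Fl) {x : Fl ⊕ N}
    (p : (P.fracGraph lam).Walk (Sum.inr v) x) : Prop :=
  p.IsPath ∧ p.snd = Sum.inl f ∧
    ∀ (y : Fl ⊕ N) (q : (P.fracGraph lam).Walk (Sum.inr v) y),
      q.IsPath → q.snd = Sum.inl f → q.length ≤ p.length

open Classical in
/-- `1` if the walk traverses the edge between `v` and `f` from `v` to `f`, `-1` if it does so from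
`f` to `v`, and `0` if it does not use this edge. -/
noncomputable def sign {G : SimpleGraph (Fl ⊕ N)} {x y : Fl ⊕ N} (p : G.Walk x y)
    (f : Fl) (v : N) : ℝ :=
  if ∃ d ∈ p.darts, d.fst = Sum.inr v ∧ d.snd = Sum.inl f then 1
  else if ∃ d ∈ p.darts, d.fst = Sum.inl f ∧ d.snd = Sum.inr v then -1
  else 0

/-- Traffic is shifted by `δ`, with alternating signs along `p` and opposite signs along `q`. In
terms of fractions, the value on an edge at flow `f` changes by `± δ / rate f`. -/
noncomputable def perturb (lam : Fl → N → ℝ) {G : SimpleGraph (Fl ⊕ N)} {x y z : Fl ⊕ N}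
    (p : G.Walk x y) (q : G.Walk x z) (δ : ℝ) : Fl → N → ℝ :=
  fun f v => lam f v + δ * (sign p f v - sign q f v)

/-- Perturbation, when there is no singleton node: choose a node `v`, two of its edges, and longest
paths through them; increase the perturbation until some fractional value becomes integral. -/
def Step2 (P : VPCA N Fl) (lam lam' : Fl → N → ℝ) : Prop :=
  (¬ ∃ v f, P.IsSingleton lam v f) ∧
  ∃ (v : N) (f g : Fl) (x y : Fl ⊕ N) (p : (P.fracGraph lam).Walk (Sum.inr v) x)
    (q : (P.fracGraph lam).Walk (Sum.inr v) y) (δ : ℝ),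
    f ≠ g ∧ P.IsEdge lam f v ∧ P.IsEdge lam g v ∧
    P.IsLongestPath lam v f p ∧ P.IsLongestPath lam v g q ∧
    0 < δ ∧
    (∀ δ', 0 ≤ δ' → δ' < δ → ∀ h u, P.IsEdge lam h u → P.IsEdge (perturb lam p q δ') h u) ∧
    (∃ h u, P.IsEdge lam h u ∧ ¬ P.IsEdge (perturb lam p q δ) h u) ∧
    lam' = perturb lam p q δ

/-- One step of Phase I. -/
def PhaseOneStep (P : VPCA N Fl) (lam lam' : Fl → N → ℝ) : Prop :=
  P.Step1 lam lam' ∨ P.Step2 lam lam'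

/-! ### MCA, Phase II -/

/-- The remaining capacity of node `v`. -/
def remCap (P : VPCA N Fl) (lam : Fl → N → ℝ) (v : N) : ℝ :=
  P.cap v - ∑ f, lam f v

/-- `f` traverses `U`, is not yet assigned, and fits in the total remaining capacity of the chosen
nodes on its route. -/
def Assignable (P : VPCA N Fl) (U : Finset N) (lam : Fl → N → ℝ) (f : Fl) : Prop :=
  (P.path f ∩ U).Nonempty ∧ ¬ P.Processed U lam f ∧
    P.rate f ≤ ∑ v ∈ P.path f ∩ U, P.remCap lam v

/-- One step of Phase II: an assignable flow `f` is split, by `x`, over chosen nodes on its route,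
within their remaining capacities. -/
def PhaseTwoStep (P : VPCA N Fl) (U : Finset N) (lam lam' : Fl → N → ℝ) : Prop :=
  ∃ (f : Fl) (x : N → ℝ), P.Assignable U lam f ∧
    (∀ v, 0 ≤ x v) ∧ (∀ v ∈ P.path f ∩ U, x v ≤ P.remCap lam v) ∧
    (∀ v, v ∉ P.path f ∩ U → x v = 0) ∧ ∑ v, x v = P.rate f ∧
    lam' = Function.update lam f x

/-- Phase II stops when no more flow can be assigned. -/
def PhaseTwoDone (P : VPCA N Fl) (U : Finset N) (lam : Fl → N → ℝ) : Prop :=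
  ∀ f, ¬ P.Assignable U lam f

/-- `lam` is a possible output of MCA for the node set `U`. -/
def MCAOutput (P : VPCA N Fl) (U : Finset N) (lam : Fl → N → ℝ) : Prop :=
  ∃ lam₀ lam₁, P.BasicOptimal U lam₀ ∧ RunsTo P.PhaseOneStep P.Rounded lam₀ lam₁ ∧
    RunsTo (P.PhaseTwoStep U) (P.PhaseTwoDone U) lam₁ lam

/-- `(U, lam)` is a possible output of RP-MCA: placement by SG (for uniform costs) or EG, followed
by MCA. -/
def RPMCAOutput (P : VPCA N Fl) (U : Finset N) (lam : Fl → N → ℝ) : Prop :=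
  (P.SGOutput U ∨ P.EGOutput U) ∧ P.MCAOutput U lam

end

end VPCA

set_option linter.unusedSectionVars false

namespace VPCA

section

variable {N Fl : Type*} [Fintype N] [DecidableEq N] [Fintype Fl] [DecidableEq Fl]

/-! ### The relaxed allocation polytope -/

theorem zero_mem_relaxed (P : VPCA N Fl) (U : Finset N) : (0 : Fl → N → ℝ) ∈ P.Relaxed U :=
  ⟨⟨fun _ _ => le_rfl, fun v _ => by simpa using P.cap_nonneg v, fun _ _ _ => rfl⟩,
    fun f => by simpa using (P.rate_pos f).le⟩

theorem le_rate_of_mem_relaxed {P : VPCA N Fl} {U : Finset N} {lam : Fl → N → ℝ}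
    (h : lam ∈ P.Relaxed U) (f : Fl) (v : N) : lam f v ≤ P.rate f := by
  by_cases hv : v ∈ U
  · exact (Finset.single_le_sum (f := fun v => lam f v) (fun u _ => h.1.1 f u) hv).trans (h.2 f)
  · rw [h.1.2.2 f v hv]; exact (P.rate_pos f).le

theorem isCompact_relaxed (P : VPCA N Fl) (U : Finset N) : IsCompact (P.Relaxed U) := by
  have hK : IsCompact (Set.univ.pi fun f : Fl => Set.univ.pi fun _ : N => Set.Icc 0 (P.rate f)) :=
    isCompact_univ_pi fun f => isCompact_univ_pi fun _ => isCompact_Icc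
  refine hK.of_isClosed_subset ?_ ?_
  · simp only [Relaxed, CapacityOK, Set.ofPred_and, Set.ofPred_forall]
    refine ((isClosed_iInter fun f => isClosed_iInter fun v => ?_).inter
      ((isClosed_iInter fun v => isClosed_iInter fun _ => ?_).inter
      (isClosed_iInter fun f => isClosed_iInter fun v => isClosed_iInter fun _ => ?_))).inter
      (isClosed_iInter fun f => ?_)
    · exact isClosed_le (by fun_prop) (by fun_prop)
    · exact isClosed_le (by fun_prop) (by fun_prop)
    · exact isClosed_eq (by fun_prop) (by fun_prop)
    · exact isClosed_le (by fun_prop) (by fun_prop)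
  · intro lam h f _ v _
    exact ⟨h.1.1 f v, le_rate_of_mem_relaxed h f v⟩

theorem R1_le_sum_rate {P : VPCA N Fl} {U : Finset N} {lam : Fl → N → ℝ}
    (h : lam ∈ P.Relaxed U) : P.R1 U lam ≤ ∑ f, P.rate f :=
  Finset.sum_le_sum fun f _ => (Finset.sum_le_sum_of_subset_of_nonneg
    Finset.inter_subset_right fun v _ _ => h.1.1 f v).trans (h.2 f)

theorem R1_le_R3 {P : VPCA N Fl} {U : Finset N} {lam : Fl → N → ℝ}
    (h : lam ∈ P.Relaxed U) : P.R1 U lam ≤ P.R3 U := by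
  refine le_csSup ⟨∑ f, P.rate f, ?_⟩ ⟨lam, h, rfl⟩
  rintro _ ⟨x, hx, rfl⟩
  exact R1_le_sum_rate hx

theorem R3_le {P : VPCA N Fl} {U : Finset N} {c : ℝ}
    (h : ∀ lam ∈ P.Relaxed U, P.R1 U lam ≤ c) : P.R3 U ≤ c := by
  refine csSup_le ⟨_, 0, P.zero_mem_relaxed U, rfl⟩ ?_
  rintro _ ⟨x, hx, rfl⟩
  exact h x hx

theorem R3_nonneg (P : VPCA N Fl) (U : Finset N) : 0 ≤ P.R3 U := by
  simpa [R1] using R1_le_R3 (P.zero_mem_relaxed U)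

theorem R3_empty (P : VPCA N Fl) : P.R3 ∅ = 0 :=
  le_antisymm (R3_le fun lam _ => by simp [R1]) (P.R3_nonneg ∅)

/-- Lowering an assignment keeps it feasible. -/
theorem CapacityOK.mono {P : VPCA N Fl} {U : Finset N} {lam mu : Fl → N → ℝ}
    (h : P.CapacityOK U lam) (h0 : ∀ f v, 0 ≤ mu f v) (hle : ∀ f v, mu f v ≤ lam f v) :
    P.CapacityOK U mu :=
  ⟨h0, fun v hv => (Finset.sum_le_sum fun f _ => hle f v).trans (h.2.1 v hv),
    fun f v hv => le_antisymm ((hle f v).trans (h.2.2 f v hv).le) (h0 f v)⟩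

theorem relaxed_of_le {P : VPCA N Fl} {U : Finset N} {lam mu : Fl → N → ℝ}
    (h : lam ∈ P.Relaxed U) (h0 : ∀ f v, 0 ≤ mu f v) (hle : ∀ f v, mu f v ≤ lam f v) :
    mu ∈ P.Relaxed U :=
  ⟨h.1.mono h0 hle, fun f => (Finset.sum_le_sum fun v _ => hle f v).trans (h.2 f)⟩

theorem exists_basicOptimal (P : VPCA N Fl) (U : Finset N) : ∃ lam, P.BasicOptimal U lam := by
  let l : StrongDual ℝ (Fl → N → ℝ) := ∑ f, ∑ v,
    (if v ∈ P.path f ∩ U then (1 : ℝ) else -1) •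
      (ContinuousLinearMap.proj (R := ℝ) (φ := fun _ : N => ℝ) v).comp
        (ContinuousLinearMap.proj (R := ℝ) (φ := fun _ : Fl => N → ℝ) f)
  have hl : ∀ lam, l lam = ∑ f, ∑ v, (if v ∈ P.path f ∩ U then (1 : ℝ) else -1) * lam f v := by
    intro lam
    simp only [l, sum_apply, smul_apply, ContinuousLinearMap.comp_apply,
      ContinuousLinearMap.proj_apply, smul_eq_mul]
  let trim : (Fl → N → ℝ) → Fl → N → ℝ := fun lam f v => if v ∈ P.path f ∩ U then lam f v else 0
  have htrim : ∀ lam ∈ P.Relaxed U, trim lam ∈ P.Relaxed U := by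
    intro lam h
    refine relaxed_of_le h (fun f v => ?_) fun f v => ?_ <;>
    · have := h.1.1 f v
      simp only [trim]; split_ifs <;> linarith
  have hltrim : ∀ lam, l (trim lam) = P.R1 U lam := by
    intro lam
    rw [hl, R1]
    refine Finset.sum_congr rfl fun f _ => ?_
    rw [← Finset.sum_subset (Finset.subset_univ (P.path f ∩ U))]
    · refine Finset.sum_congr rfl fun v hv => ?_
      simp only [trim, if_pos hv, one_mul]
    · intro v _ hv
      simp only [trim, if_neg hv, mul_zero]
  obtain ⟨x₀, hx₀, hmax⟩ := (P.isCompact_relaxed U).exists_isMaxOn ⟨0, P.zero_mem_relaxed U⟩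
    l.continuous.continuousOn
  let B : Set (Fl → N → ℝ) := {x ∈ P.Relaxed U | ∀ y ∈ P.Relaxed U, l y ≤ l x}
  have hB : IsExposed ℝ (P.Relaxed U) B := fun _ => ⟨l, rfl⟩
  obtain ⟨x, hx⟩ := (hB.isCompact (P.isCompact_relaxed U)).extremePoints_nonempty
    ⟨x₀, hx₀, fun y hy => hmax hy⟩
  have hxB : x ∈ B := hx.1
  have hxR := hxB.1
  have hoff : ∀ f v, v ∉ P.path f ∩ U → x f v = 0 := by
    have h1 := hxB.2 _ (htrim x hxR)
    rw [hl, hl] at h1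
    have hle : ∀ f v, (if v ∈ P.path f ∩ U then (1 : ℝ) else -1) * x f v ≤
        (if v ∈ P.path f ∩ U then (1 : ℝ) else -1) * trim x f v := by
      intro f v
      have := hxR.1.1 f v
      simp only [trim]; split_ifs <;> linarith
    have h2 := le_antisymm h1 (Finset.sum_le_sum fun f _ => Finset.sum_le_sum fun v _ => hle f v)
    intro f v hv
    have h3 := (Finset.sum_eq_sum_iff_of_le
      fun f _ => Finset.sum_le_sum fun v _ => hle f v).1 h2.symm f (Finset.mem_univ f)
    have h4 := (Finset.sum_eq_sum_iff_of_le fun v _ => hle f v).1 h3 v (Finset.mem_univ v)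
    simp only [trim, if_neg hv] at h4
    linarith
  have hxt : trim x = x := by
    funext f v
    by_cases hv : v ∈ P.path f ∩ U
    · simp only [trim, if_pos hv]
    · simp only [trim, if_neg hv, hoff f v hv]
  refine ⟨x, hB.isExtreme.extremePoints_subset_extremePoints hx, ?_, fun f v hv => hoff f v
    fun h => hv (Finset.mem_inter.1 h).1⟩
  refine le_antisymm (R1_le_R3 hxR) (R3_le fun lam h => ?_)
  rw [← hltrim lam, ← hltrim x, hxt]
  exact hxB.2 _ (htrim lam h)

theorem J1_le_R3 {P : VPCA N Fl} {U : Finset N} {lam : Fl → N → ℝ} (h : P.CapacityOK U lam) :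
    P.J1 U lam ≤ P.R3 U := by
  classical
  let s : Fl → ℝ := fun f => ∑ v ∈ P.path f ∩ U, lam f v
  let mu : Fl → N → ℝ := fun f v =>
    if P.Processed U lam f ∧ v ∈ P.path f then P.rate f / s f * lam f v else 0
  have hs : ∀ f, P.Processed U lam f → 0 < s f ∧ P.rate f / s f ≤ 1 := fun f hf =>
    have hpos := (P.rate_pos f).trans_le hf
    ⟨hpos, (div_le_one hpos).2 hf⟩
  have h0 : ∀ f v, 0 ≤ mu f v := by
    intro f v
    simp only [mu]
    split_ifs with hc
    · exact mul_nonneg (div_nonneg (P.rate_pos f).le (hs f hc.1).1.le) (h.1 f v)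
    · exact le_rfl
  have hle : ∀ f v, mu f v ≤ lam f v := by
    intro f v
    simp only [mu]
    split_ifs with hc
    · exact mul_le_of_le_one_left (h.1 f v) (hs f hc.1).2
    · exact h.1 f v
  have hsum : ∀ f, ∑ v ∈ P.path f ∩ U, mu f v = if P.Processed U lam f then P.rate f else 0 := by
    intro f
    split_ifs with hf
    · have : ∑ v ∈ P.path f ∩ U, mu f v = ∑ v ∈ P.path f ∩ U, P.rate f / s f * lam f v :=
        Finset.sum_congr rfl fun v hv => if_pos ⟨hf, (Finset.mem_inter.1 hv).1⟩
      rw [this, ← Finset.mul_sum]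
      exact div_mul_cancel₀ _ (hs f hf).1.ne'
    · exact Finset.sum_eq_zero fun v _ => if_neg fun hc => hf hc.1
  have hmem : mu ∈ P.Relaxed U := by
    refine ⟨h.mono h0 hle, fun f => ?_⟩
    have : ∑ v ∈ U, mu f v = ∑ v ∈ P.path f ∩ U, mu f v := by
      refine (Finset.sum_subset Finset.inter_subset_right fun v hv hv' => ?_).symm
      exact if_neg fun hc => hv' (Finset.mem_inter.2 ⟨hc.2, hv⟩)
    rw [this, hsum]
    split_ifs
    · exact le_rfl
    · exact (P.rate_pos f).le
  calc P.J1 U lam = P.R1 U mu := Finset.sum_congr rfl fun f _ => by rw [hsum]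
    _ ≤ P.R3 U := R1_le_R3 hmem

/-! ### Minimum cuts and submodularity -/

/-- The value of the cut that is given by a set `A` of flows. -/
noncomputable def cutValue (P : VPCA N Fl) (U : Finset N) (A : Finset Fl) : ℝ :=
  (∑ f, if f ∈ A then 0 else P.rate f) +
    ∑ v, if v ∈ U ∧ ∃ f ∈ A, v ∈ P.path f then P.cap v else 0

theorem R3_le_cutValue (P : VPCA N Fl) (U : Finset N) (A : Finset Fl) :
    P.R3 U ≤ P.cutValue U A := by
  refine R3_le fun lam h => ?_
  have h1 : P.R1 U lam ≤ ∑ f, ((if f ∈ A then 0 else P.rate f) +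
      ∑ v, if v ∈ U ∧ ∃ f ∈ A, v ∈ P.path f then lam f v else 0) := by
    refine Finset.sum_le_sum fun f _ => ?_
    have h2 : 0 ≤ ∑ v, if v ∈ U ∧ ∃ f ∈ A, v ∈ P.path f then lam f v else 0 :=
      Finset.sum_nonneg fun v _ => by split_ifs <;> simp [h.1.1 f v]
    split_ifs with hf
    · rw [zero_add, ← Finset.sum_filter]
      refine Finset.sum_le_sum_of_subset_of_nonneg (fun v hv => ?_) fun v _ _ => h.1.1 f v
      rw [Finset.mem_inter] at hv
      exact Finset.mem_filter.2 ⟨Finset.mem_univ v, hv.2, f, hf, hv.1⟩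
    · have := (Finset.sum_le_sum_of_subset_of_nonneg
        (Finset.inter_subset_right : P.path f ∩ U ⊆ U) fun v _ _ => h.1.1 f v).trans (h.2 f)
      linarith
  refine h1.trans ?_
  rw [Finset.sum_add_distrib, Finset.sum_comm, cutValue]
  gcongr with v
  split_ifs with hv
  · exact h.1.2.1 v hv.1
  · simp

theorem sum_indicator_right (a b : Fl) (v : N) :
    ∑ u, (if a = b ∧ u = v then (1 : ℝ) else 0) = if a = b then 1 else 0 := by
  by_cases h : a = b <;> simp [h]

theorem sum_indicator_left (a : Fl) (u v : N) :
    ∑ f, (if f = a ∧ u = v then (1 : ℝ) else 0) = if u = v then 1 else 0 := by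
  by_cases h : u = v <;> simp [h]

/-- Traffic can be moved along the alternating paths that lead from `f₀` to `g`. -/
theorem exists_direction_of_reachable (P : VPCA N Fl) (U : Finset N) (lam : Fl → N → ℝ)
    {f₀ g : Fl}
    (h : Relation.ReflTransGen (fun g h => ∃ v ∈ P.path g ∩ U, 0 < lam h v) f₀ g) :
    ∃ d : Fl → N → ℝ, (∀ f v, lam f v ≤ 0 → 0 ≤ d f v) ∧
      (∀ f v, 0 < d f v → v ∈ P.path f ∩ U) ∧ (∀ v, ∑ f, d f v = 0) ∧
      ∀ f, ∑ v, d f v = (if f = f₀ then 1 else 0) - if f = g then 1 else 0 := by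
  induction h with
  | refl => exact ⟨0, by simp, by simp, by simp, by simp⟩
  | @tail g k _ hk ih =>
    obtain ⟨v, hv, hpos⟩ := hk
    obtain ⟨d, h1, h2, h3, h4⟩ := ih
    refine ⟨fun f u => d f u + (if f = g ∧ u = v then 1 else 0) - if f = k ∧ u = v then 1 else 0,
      fun f u hu => ?_, fun f u hu => ?_, fun u => ?_, fun f => ?_⟩
    · have := h1 f u hu
      beta_reduce
      rw [if_neg (show ¬ (f = k ∧ u = v) by rintro ⟨rfl, rfl⟩; linarith)]
      split_ifs <;> linarith
    · by_cases hc : f = g ∧ u = v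
      · rw [hc.1, hc.2]; exact hv
      · refine h2 f u ?_
        simp only [if_neg hc] at hu
        split_ifs at hu <;> linarith
    · rw [Finset.sum_sub_distrib, Finset.sum_add_distrib, h3, sum_indicator_left, sum_indicator_left]
      ring
    · rw [Finset.sum_sub_distrib, Finset.sum_add_distrib, h4, sum_indicator_right,
        sum_indicator_right]
      ring

theorem eventually_nonneg_add_mul {x d : ℝ} (hx : 0 ≤ x) (hd : x ≤ 0 → 0 ≤ d) :
    ∀ᶠ ε in nhdsWithin (0 : ℝ) (Set.Ioi 0), 0 ≤ x + ε * d := by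
  rcases hx.eq_or_lt with rfl | hx
  · filter_upwards [self_mem_nhdsWithin] with ε hε
    have : 0 ≤ d := hd le_rfl
    rw [zero_add]
    exact mul_nonneg (le_of_lt hε) this
  · have hc : ContinuousAt (fun ε : ℝ => x + ε * d) 0 := by fun_prop
    have h0 : (0 : ℝ) < x + 0 * d := by simpa using hx
    exact ((hc.eventually_const_lt h0).filter_mono nhdsWithin_le_nhds).mono fun _ h => h.le

theorem eventually_le_pos {c : ℝ} (hc : 0 < c) :
    ∀ᶠ ε in nhdsWithin (0 : ℝ) (Set.Ioi 0), ε ≤ c :=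
  (Filter.eventually_of_mem (Iio_mem_nhds hc) fun _ h => le_of_lt h).filter_mono
    nhdsWithin_le_nhds

theorem not_augmentable {P : VPCA N Fl} {U : Finset N} {lam : Fl → N → ℝ}
    (h : lam ∈ P.Relaxed U) (hopt : P.R1 U lam = P.R3 U)
    (hoff : ∀ f, ∀ v, v ∉ P.path f → lam f v = 0) {f₀ g : Fl}
    (hf₀ : ∑ v ∈ U, lam f₀ v < P.rate f₀)
    (hg : Relation.ReflTransGen (fun g h => ∃ v ∈ P.path g ∩ U, 0 < lam h v) f₀ g)
    {v : N} (hv : v ∈ P.path g ∩ U) : P.cap v ≤ ∑ f, lam f v := by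
  by_contra! hlt
  obtain ⟨d, h1, h2, h3, h4⟩ := P.exists_direction_of_reachable U lam hg
  let e : Fl → N → ℝ := fun f u => d f u + if f = g ∧ u = v then 1 else 0
  have e1 : ∀ f u, lam f u ≤ 0 → 0 ≤ e f u := by
    intro f u hu
    have := h1 f u hu
    simp only [e]; split_ifs <;> linarith
  have e2 : ∀ f u, 0 < e f u → u ∈ P.path f ∩ U := by
    intro f u hu
    by_cases hc : f = g ∧ u = v
    · rw [hc.1, hc.2]; exact hv
    · simp only [e, if_neg hc, add_zero] at hu
      exact h2 f u hu
  have e3 : ∀ u, ∑ f, e f u = if u = v then 1 else 0 := by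
    intro u
    simp only [e, Finset.sum_add_distrib, h3, sum_indicator_left, zero_add]
  have e4 : ∀ f, ∑ u, e f u = if f = f₀ then 1 else 0 := by
    intro f
    simp only [e, Finset.sum_add_distrib, h4, sum_indicator_right, sub_add_cancel]
  have e0 : ∀ f u, u ∉ P.path f ∩ U → e f u = 0 := by
    intro f u hu
    have hz : lam f u ≤ 0 := by
      by_cases hp : u ∈ P.path f
      · exact (h.1.2.2 f u fun hU => hu (Finset.mem_inter.2 ⟨hp, hU⟩)).le
      · exact (hoff f u hp).le
    exact le_antisymm (not_lt.1 fun hc => hu (e2 f u hc)) (e1 f u hz)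
  obtain ⟨ε, hε, hεn, hεc, hεr⟩ : ∃ ε : ℝ, 0 < ε ∧ (∀ f u, 0 ≤ lam f u + ε * e f u) ∧
      ε ≤ P.cap v - ∑ f, lam f v ∧ ε ≤ P.rate f₀ - ∑ v ∈ U, lam f₀ v := by
    have := ((eventually_mem_nhdsWithin (a := (0 : ℝ)) (s := Set.Ioi 0)).and
      ((Filter.eventually_all.2 fun f => Filter.eventually_all.2 fun u =>
        eventually_nonneg_add_mul (h.1.1 f u) (e1 f u)).and
      ((eventually_le_pos (sub_pos.2 hlt)).and (eventually_le_pos (sub_pos.2 hf₀))))).exists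
    exact this
  have hU : ∀ f, ∑ u ∈ U, e f u = if f = f₀ then 1 else 0 := by
    intro f
    rw [← e4 f]
    exact Finset.sum_subset (Finset.subset_univ U) fun u _ hu =>
      e0 f u fun hc => hu (Finset.mem_inter.1 hc).2
  have hPU : ∀ f, ∑ u ∈ P.path f ∩ U, e f u = if f = f₀ then 1 else 0 := by
    intro f
    rw [← e4 f]
    exact Finset.sum_subset (Finset.subset_univ _) fun u _ hu => e0 f u hu
  have hmem : (fun f u => lam f u + ε * e f u) ∈ P.Relaxed U := by
    refine ⟨⟨hεn, fun u hu => ?_, fun f u hu => ?_⟩, fun f => ?_⟩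
    · rw [Finset.sum_add_distrib, ← Finset.mul_sum, e3]
      split_ifs with huv
      · subst huv; linarith
      · linarith [h.1.2.1 u hu]
    · beta_reduce
      rw [h.1.2.2 f u hu, e0 f u fun hc => hu (Finset.mem_inter.1 hc).2]; simp
    · rw [Finset.sum_add_distrib, ← Finset.mul_sum, hU]
      split_ifs with hf
      · subst hf; linarith
      · linarith [h.2 f]
  have hval : P.R1 U (fun f u => lam f u + ε * e f u) = P.R1 U lam + ε := by
    simp only [R1, Finset.sum_add_distrib, ← Finset.mul_sum, hPU]
    simp
  have := R1_le_R3 hmem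
  linarith

theorem exists_cutValue_eq (P : VPCA N Fl) (U : Finset N) : ∃ A, P.R3 U = P.cutValue U A := by
  classical
  obtain ⟨lam, hext, hopt, hoff⟩ := P.exists_basicOptimal U
  have h : lam ∈ P.Relaxed U := hext.1
  let A : Finset Fl := Finset.univ.filter fun g => ∃ f₀, ∑ v ∈ U, lam f₀ v < P.rate f₀ ∧
    Relation.ReflTransGen (fun g h => ∃ v ∈ P.path g ∩ U, 0 < lam h v) f₀ g
  have hsat : ∀ f, f ∉ A → ∑ v ∈ P.path f ∩ U, lam f v = P.rate f := by
    intro f hf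
    have h1 : ∑ v ∈ P.path f ∩ U, lam f v = ∑ v ∈ U, lam f v :=
      Finset.sum_subset Finset.inter_subset_right fun v hv hv' =>
        hoff f v fun hc => hv' (Finset.mem_inter.2 ⟨hc, hv⟩)
    rw [h1]
    refine le_antisymm (h.2 f) (not_lt.1 fun hc => hf ?_)
    exact Finset.mem_filter.2 ⟨Finset.mem_univ f, f, hc, .refl⟩
  have hcap : ∀ v, (v ∈ U ∧ ∃ f ∈ A, v ∈ P.path f) →
      P.cap v = ∑ f, lam f v ∧ ∀ f, f ∉ A → lam f v = 0 := by
    rintro v ⟨hv, g, hg, hvg⟩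
    obtain ⟨f₀, hf₀, hr⟩ := (Finset.mem_filter.1 hg).2
    have hv' := Finset.mem_inter.2 ⟨hvg, hv⟩
    refine ⟨le_antisymm (not_augmentable h hopt hoff hf₀ hr hv') (h.1.2.1 v hv), fun f hf => ?_⟩
    refine le_antisymm (not_lt.1 fun hc => hf ?_) (h.1.1 f v)
    exact Finset.mem_filter.2 ⟨Finset.mem_univ f, f₀, hf₀, hr.tail ⟨v, hv', hc⟩⟩
  refine ⟨A, ?_⟩
  have hcapsum : (∑ v, if v ∈ U ∧ ∃ f ∈ A, v ∈ P.path f then P.cap v else 0) =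
      ∑ f, ∑ v, if v ∈ U ∧ ∃ f ∈ A, v ∈ P.path f then lam f v else 0 := by
    rw [Finset.sum_comm]
    refine Finset.sum_congr rfl fun v _ => ?_
    split_ifs with hv
    · exact (hcap v hv).1
    · simp
  rw [← hopt, cutValue, hcapsum, ← Finset.sum_add_distrib, R1]
  refine Finset.sum_congr rfl fun f _ => ?_
  split_ifs with hf
  · rw [zero_add, ← Finset.sum_filter]
    refine Finset.sum_subset (fun v hv => ?_) fun v hv hv' => ?_
    · rw [Finset.mem_inter] at hv
      exact Finset.mem_filter.2 ⟨Finset.mem_univ v, hv.2, f, hf, hv.1⟩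
    · refine hoff f v fun hc => hv' (Finset.mem_inter.2 ⟨hc, (Finset.mem_filter.1 hv).2.1⟩)
  · rw [hsat f hf, Finset.sum_eq_zero, add_zero]
    intro v _
    split_ifs with hv
    · exact (hcap v hv).2 f hf
    · rfl

theorem R3_submodular (P : VPCA N Fl) (S T : Finset N) :
    P.R3 (S ∪ T) + P.R3 (S ∩ T) ≤ P.R3 S + P.R3 T := by
  obtain ⟨A, hA⟩ := P.exists_cutValue_eq S
  obtain ⟨B, hB⟩ := P.exists_cutValue_eq T
  refine (add_le_add (P.R3_le_cutValue (S ∪ T) (A ∩ B)) (P.R3_le_cutValue (S ∩ T) (A ∪ B))).trans ?_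
  rw [hA, hB]
  simp only [cutValue]
  have h1 : (∑ f, if f ∈ A ∩ B then 0 else P.rate f) + (∑ f, if f ∈ A ∪ B then 0 else P.rate f) =
      (∑ f, if f ∈ A then 0 else P.rate f) + ∑ f, if f ∈ B then 0 else P.rate f := by
    rw [← Finset.sum_add_distrib, ← Finset.sum_add_distrib]
    refine Finset.sum_congr rfl fun f _ => ?_
    by_cases ha : f ∈ A <;> by_cases hb : f ∈ B <;> simp [ha, hb]
  have h2 : (∑ v, if v ∈ S ∪ T ∧ ∃ f ∈ A ∩ B, v ∈ P.path f then P.cap v else 0) +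
      (∑ v, if v ∈ S ∩ T ∧ ∃ f ∈ A ∪ B, v ∈ P.path f then P.cap v else 0) ≤
      (∑ v, if v ∈ S ∧ ∃ f ∈ A, v ∈ P.path f then P.cap v else 0) +
      ∑ v, if v ∈ T ∧ ∃ f ∈ B, v ∈ P.path f then P.cap v else 0 := by
    rw [← Finset.sum_add_distrib, ← Finset.sum_add_distrib]
    refine Finset.sum_le_sum fun v _ => ?_
    have hc := P.cap_nonneg v
    have hi : (∃ f ∈ A ∩ B, v ∈ P.path f) → (∃ f ∈ A, v ∈ P.path f) ∧ ∃ f ∈ B, v ∈ P.path f := by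
      rintro ⟨f, hf, hv⟩
      rw [Finset.mem_inter] at hf
      exact ⟨⟨f, hf.1, hv⟩, f, hf.2, hv⟩
    have hu : (∃ f ∈ A ∪ B, v ∈ P.path f) ↔ (∃ f ∈ A, v ∈ P.path f) ∨ ∃ f ∈ B, v ∈ P.path f := by
      simp only [Finset.mem_union, or_and_right, exists_or]
    simp only [hu, Finset.mem_union (s := S), Finset.mem_inter (s₁ := S)]
    by_cases a : ∃ f ∈ A, v ∈ P.path f <;> by_cases b : ∃ f ∈ B, v ∈ P.path f <;>
    by_cases i : ∃ f ∈ A ∩ B, v ∈ P.path f <;> by_cases s : v ∈ S <;> by_cases t : v ∈ T <;>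
    first
      | exact absurd (hi i).1 a
      | exact absurd (hi i).2 b
      | simp [-Finset.mem_inter, a, b, i, s, t, hc]
  linarith

theorem R3_mono (P : VPCA N Fl) {S T : Finset N} (h : S ⊆ T) : P.R3 S ≤ P.R3 T := by
  obtain ⟨A, hA⟩ := P.exists_cutValue_eq T
  rw [hA]
  refine (P.R3_le_cutValue S A).trans ?_
  unfold cutValue
  gcongr with v
  have hc := P.cap_nonneg v
  split_ifs with h1 h2 h2
  · exact le_rfl
  · exact absurd ⟨h h1.1, h1.2⟩ h2
  · exact hc
  · exact le_rfl

theorem gain_nonneg (P : VPCA N Fl) (S : Finset N) (v : N) : 0 ≤ P.gain S v :=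
  sub_nonneg.2 (P.R3_mono (Finset.subset_insert v S))

theorem gain_anti (P : VPCA N Fl) {S T : Finset N} (h : S ⊆ T) (v : N) :
    P.gain T v ≤ P.gain S v := by
  by_cases hv : v ∈ T
  · have : P.gain T v = 0 := by rw [gain, Finset.insert_eq_of_mem hv, sub_self]
    rw [this]
    exact P.gain_nonneg S v
  · have := P.R3_submodular (insert v S) T
    rw [Finset.insert_union, Finset.union_eq_right.2 h, Finset.insert_inter_of_notMem hv,
      Finset.inter_eq_left.2 h] at this
    unfold gain
    linarith

theorem R3_le_add_sum_gain (P : VPCA N Fl) (S O : Finset N) :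
    P.R3 O ≤ P.R3 S + ∑ v ∈ O \ S, P.gain S v := by
  have key : ∀ D : Finset N, P.R3 (S ∪ D) ≤ P.R3 S + ∑ v ∈ D, P.gain S v := by
    intro D
    induction D using Finset.induction_on with
    | empty => simp
    | insert v D hv ih =>
      rw [Finset.sum_insert hv, Finset.union_insert]
      have := P.gain_anti (Finset.subset_union_left : S ⊆ S ∪ D) v
      rw [gain] at this
      linarith
  refine (P.R3_mono ?_).trans (key (O \ S))
  rw [Finset.union_sdiff_self_eq_union]
  exact Finset.subset_union_right

/-! ### Greedy placement -/

theorem Affordable.subset {P : VPCA N Fl} {S T : Finset N} (h : P.Affordable T) (hST : S ⊆ T) :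
    P.Affordable S :=
  (Finset.sum_le_sum_of_subset_of_nonneg hST fun v _ _ => (P.cost_pos v).le).trans h

theorem affordable_empty (P : VPCA N Fl) : P.Affordable ∅ := by
  simpa [Affordable] using P.budget_nonneg

/-- Adding a node of largest density shrinks the gap to `O` geometrically. -/
theorem gap_insert_le (P : VPCA N Fl) {S O : Finset N} {v : N} {W K a : ℝ} (hW : 0 < W)
    (hK : 0 ≤ K) (hO : ∑ w ∈ O \ S, P.cost w ≤ W)
    (hv : ∀ w ∈ O \ S, P.gain S w / P.cost w ≤ P.gain S v / P.cost v)
    (hS : P.R3 O - P.R3 S ≤ Real.exp (-a) * K) :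
    P.R3 O - P.R3 (insert v S) ≤ Real.exp (-(a + P.cost v / W)) * K := by
  have hg := P.gain_nonneg S v
  have hins : P.R3 (insert v S) = P.R3 S + P.gain S v := by rw [gain]; ring
  rcases le_total (P.R3 O - P.R3 S) 0 with hD | hD
  · exact le_trans (by linarith) (mul_nonneg (Real.exp_pos _).le hK)
  have hc := P.cost_pos v
  have hρ : 0 ≤ P.gain S v / P.cost v := div_nonneg hg hc.le
  have h1 : P.R3 O - P.R3 S ≤ P.gain S v / P.cost v * W := by
    have h2 : ∑ w ∈ O \ S, P.gain S w ≤ ∑ w ∈ O \ S, P.gain S v / P.cost v * P.cost w :=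
      Finset.sum_le_sum fun w hw => (div_le_iff₀ (P.cost_pos w)).1 (hv w hw)
    rw [← Finset.mul_sum] at h2
    have h3 := mul_le_mul_of_nonneg_left hO hρ
    linarith [P.R3_le_add_sum_gain S O]
  have h2 : P.cost v / W * (P.R3 O - P.R3 S) ≤ P.gain S v := by
    calc P.cost v / W * (P.R3 O - P.R3 S)
        ≤ P.cost v / W * (P.gain S v / P.cost v * W) :=
          mul_le_mul_of_nonneg_left h1 (div_nonneg hc.le hW.le)
      _ = P.gain S v := by field_simp
  calc P.R3 O - P.R3 (insert v S)
      ≤ (1 - P.cost v / W) * (P.R3 O - P.R3 S) := by rw [hins]; linarith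
    _ ≤ Real.exp (-(P.cost v / W)) * (P.R3 O - P.R3 S) :=
        mul_le_mul_of_nonneg_right (Real.one_sub_le_exp_neg _) hD
    _ ≤ Real.exp (-(P.cost v / W)) * (Real.exp (-a) * K) :=
        mul_le_mul_of_nonneg_left hS (Real.exp_pos _).le
    _ = Real.exp (-(a + P.cost v / W)) * K := by
        rw [← mul_assoc, ← Real.exp_add]; ring_nf

theorem one_sub_inv_exp_mul_le {x : ℝ} (hx : 0 ≤ x) : (1 - 1 / Real.exp 1) * x ≤ x := by
  have : 0 ≤ 1 / Real.exp 1 * x := mul_nonneg (one_div_pos.2 (Real.exp_pos 1)).le hx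
  linarith

theorem exp_neg_one_eq : Real.exp (-1) = 1 / Real.exp 1 := by
  rw [Real.exp_neg, one_div]

/-! #### Submodular greedy -/

theorem sum_cost_of_uniform {P : VPCA N Fl} {b : ℝ} (hb : ∀ v, P.cost v = b) (S : Finset N) :
    ∑ v ∈ S, P.cost v = S.card * b := by
  simp [hb]

theorem affordable_iff_of_uniform {P : VPCA N Fl} {b : ℝ} (hb : ∀ v, P.cost v = b) (hb0 : 0 < b)
    (S : Finset N) : P.Affordable S ↔ S.card ≤ ⌊P.budget / b⌋₊ := by
  rw [Affordable, sum_cost_of_uniform hb, Nat.le_floor_iff (div_nonneg P.budget_nonneg hb0.le),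
    le_div_iff₀ hb0]

theorem SGOutput.affordable {P : VPCA N Fl} {U : Finset N} (h : P.SGOutput U) :
    P.Affordable U := by
  obtain ⟨b, hb, -, hdone⟩ := h
  rcases isEmpty_or_nonempty N with hN | ⟨⟨v⟩⟩
  · rw [Finset.eq_empty_of_isEmpty U]; exact P.affordable_empty
  · have hb0 : 0 < b := hb v ▸ P.cost_pos v
    exact (affordable_iff_of_uniform hb hb0 U).2 (hdone.le.trans (min_le_left _ _))

theorem SGOutput.bound {P : VPCA N Fl} {U : Finset N} (h : P.SGOutput U) {O : Finset N}
    (hO : P.Affordable O) : (1 - 1 / Real.exp 1) * P.R3 O ≤ P.R3 U := by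
  obtain ⟨b, hb, hrun, hdone⟩ := h
  rcases isEmpty_or_nonempty N with hN | ⟨⟨v⟩⟩
  · rw [Subsingleton.elim U O]; exact one_sub_inv_exp_mul_le (P.R3_nonneg O)
  have hb0 : 0 < b := hb v ▸ P.cost_pos v
  rw [affordable_iff_of_uniform hb hb0] at hO
  set k := ⌊P.budget / b⌋₊ with hk
  rcases le_or_gt (Fintype.card N) k with hNk | hNk
  · rw [min_eq_right hNk, Finset.card_eq_iff_eq_univ] at hdone
    rw [hdone]
    exact (one_sub_inv_exp_mul_le (P.R3_nonneg O)).trans (P.R3_mono (Finset.subset_univ O))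
  rcases Nat.eq_zero_or_pos k with hk0 | hk0
  · rw [hk0, Nat.le_zero, Finset.card_eq_zero] at hO
    rw [hO, R3_empty, mul_zero]
    exact P.R3_nonneg U
  have hkR : (0 : ℝ) < k := by exact_mod_cast hk0
  have key : ∀ S, Relation.ReflTransGen (P.SGStep k) ∅ S →
      P.R3 O - P.R3 S ≤ Real.exp (-(S.card / k)) * P.R3 O := by
    intro S hS
    induction hS with
    | refl => simp [R3_empty]
    | tail _ hstep ih =>
      obtain ⟨-, v, hv, hmax, rfl⟩ := hstep
      have hW : (0 : ℝ) < k * b := mul_pos hkR hb0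
      have := P.gap_insert_le (v := v) hW (P.R3_nonneg O) (O := O) ?_ ?_ ih
      · rw [Finset.card_insert_of_notMem hv]
        convert this using 4
        rw [hb v]
        push_cast
        field_simp
      · rw [sum_cost_of_uniform hb]
        refine mul_le_mul_of_nonneg_right ?_ hb0.le
        exact_mod_cast (Finset.card_le_card Finset.sdiff_subset).trans hO
      · intro w hw
        rw [hb, hb]
        exact div_le_div_of_nonneg_right (hmax w (Finset.mem_sdiff.1 hw).2) hb0.le
  have := key U hrun
  rw [hdone, min_eq_left hNk.le, div_self hkR.ne', exp_neg_one_eq] at this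
  linarith

theorem exists_sgOutput (P : VPCA N Fl) (h : ∃ b, ∀ v, P.cost v = b) : ∃ U, P.SGOutput U := by
  obtain ⟨b, hb⟩ := h
  have key : ∀ j, j ≤ min ⌊P.budget / b⌋₊ (Fintype.card N) →
      ∃ S : Finset N, Relation.ReflTransGen (P.SGStep ⌊P.budget / b⌋₊) ∅ S ∧ S.card = j := by
    intro j
    induction j with
    | zero => exact fun _ => ⟨∅, .refl, rfl⟩
    | succ j ih =>
      intro hj
      obtain ⟨S, hS, hc⟩ := ih (by omega)
      have hne : Sᶜ.Nonempty := by
        rw [← Finset.card_pos, Finset.card_compl]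
        omega
      obtain ⟨v, hv, hmax⟩ := Finset.exists_max_image Sᶜ (P.gain S) hne
      rw [Finset.mem_compl] at hv
      refine ⟨insert v S, hS.tail ⟨by omega, v, hv, fun w hw => ?_, rfl⟩, ?_⟩
      · exact hmax w (Finset.mem_compl.2 hw)
      · rw [Finset.card_insert_of_notMem hv, hc]
  obtain ⟨S, hS, hc⟩ := key _ le_rfl
  exact ⟨S, b, hb, hS, hc⟩

/-! #### Enumeration-based greedy -/

theorem exists_augmentation (P : VPCA N Fl) (T : Finset N) :
    ∃ S, RunsTo P.AugStep (fun S => ¬ ∃ v, P.Fits S v) T S := by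
  induction hn : Tᶜ.card using Nat.strong_induction_on generalizing T with
  | _ n ih =>
    by_cases hfit : ∃ v, P.Fits T v
    · classical
      have hne : (Finset.univ.filter (P.Fits T)).Nonempty := by
        obtain ⟨v, hv⟩ := hfit
        exact ⟨v, Finset.mem_filter.2 ⟨Finset.mem_univ v, hv⟩⟩
      obtain ⟨v, hv, hmax⟩ := Finset.exists_max_image _ (fun v => P.gain T v / P.cost v) hne
      have hv := (Finset.mem_filter.1 hv).2
      have hlt : (insert v T)ᶜ.card < n := by
        rw [← hn]
        refine Finset.card_lt_card (Finset.ssubset_iff_of_subset ?_ |>.2 ⟨v, ?_, ?_⟩)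
        · exact Finset.compl_subset_compl.2 (Finset.subset_insert v T)
        · exact Finset.mem_compl.2 hv.1
        · simp
      obtain ⟨S, hS, hdone⟩ := ih _ hlt (insert v T) rfl
      exact ⟨S, .head ⟨v, hv, fun w hw => hmax w
        (Finset.mem_filter.2 ⟨Finset.mem_univ w, hw⟩), rfl⟩ hS, hdone⟩
    · exact ⟨T, .refl, hfit⟩

theorem exists_egOutput (P : VPCA N Fl) : ∃ U, P.EGOutput U := by
  choose aug haug using P.exists_augmentation
  let cand : Set (Finset N) := {S | P.Affordable S ∧ (S.card = 1 ∨ S.card = 2)} ∪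
    aug '' {T | T.card = 3 ∧ P.Affordable T}
  rcases cand.eq_empty_or_nonempty with h | h
  · exact ⟨∅, aug, cand, fun T _ _ => haug T, rfl, .inr ⟨h, rfl⟩⟩
  · obtain ⟨U, hU, hmax⟩ := Set.exists_max_image cand P.R3 cand.toFinite h
    exact ⟨U, aug, cand, fun T _ _ => haug T, rfl, .inl ⟨hU, hmax⟩⟩

theorem affordable_of_augStep {P : VPCA N Fl} {T S : Finset N}
    (h : Relation.ReflTransGen P.AugStep T S) (hT : P.Affordable T) : P.Affordable S := by
  induction h with
  | refl => exact hT
  | tail _ hstep _ =>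
    obtain ⟨v, hv, -, rfl⟩ := hstep
    exact hv.2

theorem subset_of_augStep {P : VPCA N Fl} {T S : Finset N}
    (h : Relation.ReflTransGen P.AugStep T S) : T ⊆ S := by
  induction h with
  | refl => exact subset_rfl
  | tail _ hstep ih =>
    obtain ⟨v, -, -, rfl⟩ := hstep
    exact ih.trans (Finset.subset_insert _ _)

theorem EGOutput.affordable {P : VPCA N Fl} {U : Finset N} (h : P.EGOutput U) :
    P.Affordable U := by
  obtain ⟨aug, cand, haug, rfl, ⟨hU, -⟩ | ⟨-, rfl⟩⟩ := h
  · rcases hU with hU | ⟨T, hT, rfl⟩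
    · exact hU.1
    · exact affordable_of_augStep (haug T hT.1 hT.2).1 hT.2
  · exact P.affordable_empty

/-- If the densest remaining node of `O` does not fit, then the target value is reached already. -/
theorem bound_of_not_affordable (P : VPCA N Fl) {T S O : Finset N} {u : N} (hTO : T ⊆ O)
    (hO : P.Affordable O) (hTS : T ⊆ S) (hu : u ∈ O \ S)
    (hmax : ∀ w ∈ O \ S, P.gain S w / P.cost w ≤ P.gain S u / P.cost u)
    (hgain : P.gain S u ≤ P.R3 T / 3) (hfit : ¬ P.Affordable (insert u S))
    (hS : P.R3 O - P.R3 S ≤ Real.exp (-((∑ v ∈ S, P.cost v - ∑ v ∈ T, P.cost v) /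
      (P.budget - ∑ v ∈ T, P.cost v))) * (P.R3 O - P.R3 T)) :
    (1 - 1 / Real.exp 1) * P.R3 O ≤ P.R3 S := by
  rw [Finset.mem_sdiff] at hu
  have hcO : ∑ v ∈ O \ T, P.cost v ≤ P.budget - ∑ v ∈ T, P.cost v := by
    have h1 := Finset.sum_sdiff (f := P.cost) hTO
    have h2 : ∑ v ∈ O, P.cost v ≤ P.budget := hO
    linarith
  have hW : 0 < P.budget - ∑ v ∈ T, P.cost v := by
    refine (Finset.sum_pos (fun v _ => P.cost_pos v) ⟨u, ?_⟩).trans_le hcO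
    exact Finset.mem_sdiff.2 ⟨hu.1, fun h => hu.2 (hTS h)⟩
  have hK : 0 ≤ P.R3 O - P.R3 T := sub_nonneg.2 (P.R3_mono hTO)
  have h1 := P.gap_insert_le hW hK ((Finset.sum_le_sum_of_subset_of_nonneg
    (Finset.sdiff_subset_sdiff subset_rfl hTS) fun v _ _ => (P.cost_pos v).le).trans hcO) hmax hS
  rw [← add_div] at h1
  have h2 : 1 ≤ (∑ v ∈ S, P.cost v - ∑ v ∈ T, P.cost v + P.cost u) /
      (P.budget - ∑ v ∈ T, P.cost v) := by
    rw [Affordable, Finset.sum_insert hu.2, not_le] at hfit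
    rw [one_le_div hW]
    linarith
  have h3 := h1.trans (mul_le_mul_of_nonneg_right (Real.exp_le_exp.2 (neg_le_neg h2)) hK)
  rw [exp_neg_one_eq] at h3
  have h4 : P.R3 (insert u S) = P.R3 S + P.gain S u := by rw [gain]; ring
  have h5 : 1 / 3 ≤ 1 / Real.exp 1 :=
    one_div_le_one_div_of_le (Real.exp_pos 1) (by linarith [Real.exp_one_lt_d9])
  have h6 := mul_le_mul_of_nonneg_right h5 (P.R3_nonneg T)
  linarith

theorem bound_of_augmentation (P : VPCA N Fl) {T S O : Finset N} (hTO : T ⊆ O)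
    (hO : P.Affordable O) (hgain : ∀ u ∈ O \ T, P.gain T u ≤ P.R3 T / 3)
    (hS : RunsTo P.AugStep (fun S => ¬ ∃ v, P.Fits S v) T S) :
    (1 - 1 / Real.exp 1) * P.R3 O ≤ P.R3 S := by
  have hcase : ∀ S, T ⊆ S →
      P.R3 O - P.R3 S ≤ Real.exp (-((∑ v ∈ S, P.cost v - ∑ v ∈ T, P.cost v) /
        (P.budget - ∑ v ∈ T, P.cost v))) * (P.R3 O - P.R3 T) →
      (1 - 1 / Real.exp 1) * P.R3 O ≤ P.R3 S ∨ ∃ u ∈ O \ S, P.Fits S u ∧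
        ∀ w ∈ O \ S, P.gain S w / P.cost w ≤ P.gain S u / P.cost u := by
    intro S hTS hgap
    rcases (O \ S).eq_empty_or_nonempty with he | hne
    · exact .inl ((one_sub_inv_exp_mul_le (P.R3_nonneg O)).trans
        (P.R3_mono (Finset.sdiff_eq_empty_iff_subset.1 he)))
    · obtain ⟨u, hu, hmax⟩ := Finset.exists_max_image _ (fun v => P.gain S v / P.cost v) hne
      by_cases hfit : P.Affordable (insert u S)
      · exact .inr ⟨u, hu, ⟨(Finset.mem_sdiff.1 hu).2, hfit⟩, hmax⟩
      · exact .inl (P.bound_of_not_affordable hTO hO hTS hu hmax ((P.gain_anti hTS u).trans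
          (hgain u (Finset.sdiff_subset_sdiff subset_rfl hTS hu))) hfit hgap)
  have key : ∀ S, Relation.ReflTransGen P.AugStep T S →
      P.R3 O - P.R3 S ≤ Real.exp (-((∑ v ∈ S, P.cost v - ∑ v ∈ T, P.cost v) /
        (P.budget - ∑ v ∈ T, P.cost v))) * (P.R3 O - P.R3 T) ∨
      (1 - 1 / Real.exp 1) * P.R3 O ≤ P.R3 S := by
    intro S hS
    induction hS with
    | refl => simp
    | @tail S _ hr hstep ih =>
      obtain ⟨v, hv, hmax, rfl⟩ := hstep
      have hmono := P.R3_mono (Finset.subset_insert v S)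
      have hTS := subset_of_augStep hr
      rcases ih with ih | ih
      · rcases hcase S hTS ih with h | ⟨u, hu, hfit, hu'⟩
        · exact .inr (h.trans hmono)
        · left
          have hcO : ∑ v ∈ O \ T, P.cost v ≤ P.budget - ∑ v ∈ T, P.cost v := by
            have h1 := Finset.sum_sdiff (f := P.cost) hTO
            have h2 : ∑ v ∈ O, P.cost v ≤ P.budget := hO
            linarith
          have hW : 0 < P.budget - ∑ v ∈ T, P.cost v :=
            (Finset.sum_pos (fun v _ => P.cost_pos v)
              ⟨u, Finset.sdiff_subset_sdiff subset_rfl hTS hu⟩).trans_le hcO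
          have := P.gap_insert_le (v := v) hW (sub_nonneg.2 (P.R3_mono hTO))
            ((Finset.sum_le_sum_of_subset_of_nonneg (Finset.sdiff_subset_sdiff subset_rfl hTS)
              fun v _ _ => (P.cost_pos v).le).trans hcO)
            (fun w hw => (hu' w hw).trans (hmax u hfit)) ih
          rw [← add_div] at this
          rw [Finset.sum_insert hv.1]
          convert this using 5
          ring
      · exact .inr (ih.trans hmono)
  rcases key S hS.1 with h | h
  · rcases hcase S (subset_of_augStep hS.1) h with h | ⟨u, -, hfit, -⟩
    · exact h
    · exact absurd ⟨u, hfit⟩ hS.2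
  · exact h

/-- Three nodes of `O` that are chosen greedily. -/
theorem exists_greedy_triple (P : VPCA N Fl) {O : Finset N} (hO : 3 ≤ O.card) :
    ∃ T ⊆ O, T.card = 3 ∧ ∀ u ∈ O \ T, P.gain T u ≤ P.R3 T / 3 := by
  have next : ∀ S ⊆ O, S.card < 3 → ∃ v ∈ O \ S, ∀ w ∈ O \ S, P.gain S w ≤ P.gain S v := by
    intro S hS hc
    refine Finset.exists_max_image _ _ ?_
    rw [← Finset.card_pos, Finset.card_sdiff_of_subset hS]
    omega
  obtain ⟨a, ha, hamax⟩ := next ∅ (Finset.empty_subset O) (by simp)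
  rw [Finset.mem_sdiff] at ha
  have hS1 : insert a ∅ ⊆ O := Finset.insert_subset ha.1 (Finset.empty_subset O)
  have hc1 : (insert a (∅ : Finset N)).card = 1 := by simp
  obtain ⟨b, hb, hbmax⟩ := next (insert a ∅) hS1 (by omega)
  rw [Finset.mem_sdiff] at hb
  have hS2 : insert b (insert a ∅) ⊆ O := Finset.insert_subset hb.1 hS1
  have hc2 : (insert b (insert a (∅ : Finset N))).card = 2 := by
    rw [Finset.card_insert_of_notMem hb.2, hc1]
  obtain ⟨c, hc, hcmax⟩ := next (insert b (insert a ∅)) hS2 (by omega)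
  rw [Finset.mem_sdiff] at hc
  refine ⟨insert c (insert b (insert a ∅)), Finset.insert_subset hc.1 hS2, ?_, fun u hu => ?_⟩
  · rw [Finset.card_insert_of_notMem hc.2, hc2]
  · have i1 : (∅ : Finset N) ⊆ insert a ∅ := Finset.subset_insert _ _
    have i2 : insert a (∅ : Finset N) ⊆ insert b (insert a ∅) := Finset.subset_insert _ _
    have i3 : insert b (insert a (∅ : Finset N)) ⊆ insert c (insert b (insert a ∅)) :=
      Finset.subset_insert _ _
    have sub : ∀ {X Y : Finset N}, X ⊆ Y → O \ Y ⊆ O \ X := fun h =>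
      Finset.sdiff_subset_sdiff subset_rfl h
    have h3 := (P.gain_anti i3 u).trans (hcmax u (sub i3 hu))
    have h2 := (P.gain_anti (i2.trans i3) u).trans (hbmax u (sub (i2.trans i3) hu))
    have h1 := (P.gain_anti (i1.trans (i2.trans i3)) u).trans
      (hamax u (sub (i1.trans (i2.trans i3)) hu))
    have h0 := P.R3_empty
    have e1 : P.gain ∅ a = P.R3 (insert a ∅) - P.R3 ∅ := rfl
    have e2 : P.gain (insert a ∅) b = P.R3 (insert b (insert a ∅)) - P.R3 (insert a ∅) := rfl
    have e3 : P.gain (insert b (insert a ∅)) c =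
      P.R3 (insert c (insert b (insert a ∅))) - P.R3 (insert b (insert a ∅)) := rfl
    linarith

theorem EGOutput.bound {P : VPCA N Fl} {U : Finset N} (h : P.EGOutput U) {O : Finset N}
    (hO : P.Affordable O) : (1 - 1 / Real.exp 1) * P.R3 O ≤ P.R3 U := by
  obtain ⟨aug, cand, haug, rfl, hU⟩ := h
  rcases O.eq_empty_or_nonempty with rfl | hne
  · rw [R3_empty, mul_zero]; exact P.R3_nonneg U
  have hpos := hne.card_pos
  rcases lt_or_ge O.card 3 with hc | hc
  · have hmem : O ∈ {S | P.Affordable S ∧ (S.card = 1 ∨ S.card = 2)} ∪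
        aug '' {T | T.card = 3 ∧ P.Affordable T} := .inl ⟨hO, by omega⟩
    rcases hU with ⟨-, hmax⟩ | ⟨he, -⟩
    · exact (one_sub_inv_exp_mul_le (P.R3_nonneg O)).trans (hmax O hmem)
    · rw [he] at hmem; exact absurd hmem (Set.notMem_empty O)
  · obtain ⟨T, hTO, hT3, hgain⟩ := P.exists_greedy_triple hc
    have hT := hO.subset hTO
    have hmem : aug T ∈ {S | P.Affordable S ∧ (S.card = 1 ∨ S.card = 2)} ∪
        aug '' {T | T.card = 3 ∧ P.Affordable T} := .inr ⟨T, ⟨hT3, hT⟩, rfl⟩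
    rcases hU with ⟨-, hmax⟩ | ⟨he, -⟩
    · exact (P.bound_of_augmentation hTO hO hgain (haug T hT3 hT)).trans (hmax _ hmem)
    · rw [he] at hmem; exact absurd hmem (Set.notMem_empty _)

/-! ### The graph of fractional assignments -/

theorem isEdge_iff {P : VPCA N Fl} {lam : Fl → N → ℝ} {f : Fl} {v : N} :
    P.IsEdge lam f v ↔ 0 < lam f v ∧ lam f v < P.rate f := by
  rw [IsEdge, frac, div_lt_one (P.rate_pos f)]
  exact and_congr_left fun _ => div_pos_iff_of_pos_right (P.rate_pos f)

theorem not_isEdge_iff {P : VPCA N Fl} {lam : Fl → N → ℝ} {f : Fl} {v : N} :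
    ¬ P.IsEdge lam f v ↔ lam f v ≤ 0 ∨ P.rate f ≤ lam f v := by
  rw [isEdge_iff, not_and_or, not_lt, not_lt]

theorem fracGraph_adj_iff {P : VPCA N Fl} {lam : Fl → N → ℝ} {f : Fl} {v : N} :
    (P.fracGraph lam).Adj (.inr v) (.inl f) ↔ P.IsEdge lam f v := by
  simp [fracGraph]

theorem fracGraph_bipartite (P : VPCA N Fl) (lam : Fl → N → ℝ) {a b : Fl ⊕ N}
    (h : (P.fracGraph lam).Adj a b) :
    ∃ f v, P.IsEdge lam f v ∧ (a = .inr v ∧ b = .inl f ∨ a = .inl f ∧ b = .inr v) := by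
  rw [fracGraph, SimpleGraph.fromRel_adj] at h
  obtain ⟨-, ⟨f, v, ha, hb, he⟩ | ⟨f, v, hb, ha, he⟩⟩ := h
  · exact ⟨f, v, he, .inr ⟨ha, hb⟩⟩
  · exact ⟨f, v, he, .inl ⟨ha, hb⟩⟩

theorem fracGraph_mono {P : VPCA N Fl} {lam mu : Fl → N → ℝ}
    (h : ∀ f v, P.IsEdge mu f v → P.IsEdge lam f v) : P.fracGraph mu ≤ P.fracGraph lam := by
  intro a b hab
  obtain ⟨f, v, he, ⟨rfl, rfl⟩ | ⟨rfl, rfl⟩⟩ := P.fracGraph_bipartite mu hab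
  · exact fracGraph_adj_iff.2 (h f v he)
  · exact (fracGraph_adj_iff.2 (h f v he)).symm

/-! ### Signs along walks -/

section Sign

variable {G : SimpleGraph (Fl ⊕ N)}

/-- The number of times a walk runs from `v` to `f`, minus the number of times it runs from `f` to
`v`. -/
noncomputable def walkSign {x y : Fl ⊕ N} (p : G.Walk x y) (f : Fl) (v : N) : ℝ :=
  (p.darts.map fun d => (if d.fst = .inr v ∧ d.snd = .inl f then 1 else 0) -
    if d.fst = .inl f ∧ d.snd = .inr v then 1 else 0).sum

theorem walkSign_cons {x y z : Fl ⊕ N} (h : G.Adj x y) (p : G.Walk y z) (f : Fl) (v : N) :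
    walkSign (.cons h p) f v = (if x = .inr v ∧ y = .inl f then 1 else 0) -
      (if x = .inl f ∧ y = .inr v then 1 else 0) + walkSign p f v := by
  simp [walkSign]

theorem sign_eq_zero {x y : Fl ⊕ N} {p : G.Walk x y} {f : Fl} {v : N}
    (h : s(.inr v, .inl f) ∉ p.edges) : sign p f v = 0 := by
  have h1 : ¬ ∃ d ∈ p.darts, d.fst = .inr v ∧ d.snd = .inl f := by
    rintro ⟨d, hd, h1, h2⟩
    refine h (List.mem_map.2 ⟨d, hd, ?_⟩)
    rw [← h1, ← h2]; rfl
  have h2 : ¬ ∃ d ∈ p.darts, d.fst = .inl f ∧ d.snd = .inr v := by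
    rintro ⟨d, hd, h1, h2⟩
    refine h (List.mem_map.2 ⟨d, hd, ?_⟩)
    rw [← h1, ← h2, Sym2.eq_swap]; rfl
  rw [sign, if_neg h1, if_neg h2]

theorem sign_eq_walkSign {x y : Fl ⊕ N} {p : G.Walk x y} (hp : p.IsTrail) (f : Fl) (v : N) :
    sign p f v = walkSign p f v := by
  induction p with
  | nil => simp [sign, walkSign]
  | @cons a b c h p ih =>
    rw [SimpleGraph.Walk.isTrail_cons] at hp
    rw [walkSign_cons, ← ih hp.1]
    by_cases h1 : a = .inr v ∧ b = .inl f
    · obtain ⟨rfl, rfl⟩ := h1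
      rw [sign_eq_zero hp.2]
      simp [sign]
    · by_cases h2 : a = .inl f ∧ b = .inr v
      · obtain ⟨rfl, rfl⟩ := h2
        have hn : s(.inr v, .inl f) ∉ p.edges := by rw [Sym2.eq_swap]; exact hp.2
        have h3 : ¬ ∃ d ∈ p.darts, d.fst = .inr v ∧ d.snd = .inl f := by
          rintro ⟨d, hd, h1, h2⟩
          refine hn (List.mem_map.2 ⟨d, hd, ?_⟩)
          rw [← h1, ← h2]; rfl
        rw [sign_eq_zero hn]
        simp only [sign, SimpleGraph.Walk.darts_cons, List.mem_cons, exists_eq_or_imp, h3]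
        simp
      · simp only [sign, SimpleGraph.Walk.darts_cons, List.mem_cons, exists_eq_or_imp, h1, h2,
          false_or, if_false]
        ring

theorem walkSign_sum_flows (hG : ∀ a b, G.Adj a b → ∃ (f : Fl) (v : N),
      a = .inr v ∧ b = .inl f ∨ a = .inl f ∧ b = .inr v)
    {x y : Fl ⊕ N} (p : G.Walk x y) (v : N) :
    ∑ f, walkSign p f v = (if x = .inr v then 1 else 0) - if y = .inr v then 1 else 0 := by
  induction p with
  | nil => simp [walkSign]
  | @cons a b c h p ih =>
    simp only [walkSign_cons, Finset.sum_add_distrib, Finset.sum_sub_distrib, ih]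
    obtain ⟨g, w, ⟨rfl, rfl⟩ | ⟨rfl, rfl⟩⟩ := hG a b h
    · by_cases hw : w = v
      · simp [hw]; ring
      · simp [hw]
    · by_cases hw : w = v
      · simp [hw]; ring
      · simp [hw]

theorem walkSign_sum_nodes (hG : ∀ a b, G.Adj a b → ∃ (f : Fl) (v : N),
      a = .inr v ∧ b = .inl f ∨ a = .inl f ∧ b = .inr v)
    {x y : Fl ⊕ N} (p : G.Walk x y) (f : Fl) :
    ∑ v, walkSign p f v = (if y = .inl f then 1 else 0) - if x = .inl f then 1 else 0 := by
  induction p with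
  | nil => simp [walkSign]
  | @cons a b c h p ih =>
    simp only [walkSign_cons, Finset.sum_add_distrib, Finset.sum_sub_distrib, ih]
    obtain ⟨g, w, ⟨rfl, rfl⟩ | ⟨rfl, rfl⟩⟩ := hG a b h
    · by_cases hg : g = f <;> simp [hg]
    · by_cases hg : g = f
      · simp [hg]; ring
      · simp [hg]

end Sign

theorem sum_sign_flows {P : VPCA N Fl} {lam : Fl → N → ℝ} {x y : Fl ⊕ N}
    {p : (P.fracGraph lam).Walk x y} (hp : p.IsTrail) (v : N) :
    ∑ f, sign p f v = (if x = .inr v then 1 else 0) - if y = .inr v then 1 else 0 := by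
  simp only [sign_eq_walkSign hp]
  exact walkSign_sum_flows (fun a b h =>
    let ⟨f, v, _, h'⟩ := P.fracGraph_bipartite lam h; ⟨f, v, h'⟩) p v

theorem sum_sign_nodes {P : VPCA N Fl} {lam : Fl → N → ℝ} {x y : Fl ⊕ N}
    {p : (P.fracGraph lam).Walk x y} (hp : p.IsTrail) (f : Fl) :
    ∑ v, sign p f v = (if y = .inl f then 1 else 0) - if x = .inl f then 1 else 0 := by
  simp only [sign_eq_walkSign hp]
  exact walkSign_sum_nodes (fun a b h =>
    let ⟨f, v, _, h'⟩ := P.fracGraph_bipartite lam h; ⟨f, v, h'⟩) p f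

theorem sign_eq_zero_of_not_isEdge {P : VPCA N Fl} {lam : Fl → N → ℝ} {x y : Fl ⊕ N}
    (p : (P.fracGraph lam).Walk x y) {f : Fl} {v : N} (h : ¬ P.IsEdge lam f v) :
    sign p f v = 0 :=
  sign_eq_zero fun hc => h (fracGraph_adj_iff.1 (p.adj_of_mem_edges hc))

/-! ### Basic solutions have acyclic graphs -/

theorem mem_of_isEdge {P : VPCA N Fl} {U : Finset N} {lam : Fl → N → ℝ}
    (h : lam ∈ P.Relaxed U) {f : Fl} {v : N} (he : P.IsEdge lam f v) : v ∈ U := by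
  by_contra hv
  have := (isEdge_iff.1 he).1
  rw [h.1.2.2 f v hv] at this
  exact lt_irrefl _ this

/-- Shifting traffic on edges keeps an assignment feasible if all node loads are kept. -/
theorem add_mem_relaxed {P : VPCA N Fl} {U : Finset N} {lam d : Fl → N → ℝ} {δ : ℝ}
    (h : lam ∈ P.Relaxed U) (hd : ∀ f v, ¬ P.IsEdge lam f v → d f v = 0)
    (hnode : ∀ v, ∑ f, d f v = 0) (hnonneg : ∀ f v, 0 ≤ lam f v + δ * d f v)
    (hflow : ∀ f, ∑ v ∈ U, (lam f v + δ * d f v) ≤ P.rate f) :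
    (fun f v => lam f v + δ * d f v) ∈ P.Relaxed U := by
  refine ⟨⟨hnonneg, fun v hv => ?_, fun f v hv => ?_⟩, hflow⟩
  · rw [Finset.sum_add_distrib, ← Finset.mul_sum, hnode, mul_zero, add_zero]
    exact h.1.2.1 v hv
  · beta_reduce
    rw [h.1.2.2 f v hv, hd f v fun he => hv (mem_of_isEdge h he), mul_zero, add_zero]

theorem sum_shift_eq {P : VPCA N Fl} {U : Finset N} {lam d : Fl → N → ℝ}
    (h : lam ∈ P.Relaxed U) (hd : ∀ f v, ¬ P.IsEdge lam f v → d f v = 0) (δ : ℝ) (f : Fl) :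
    ∑ v ∈ U, (lam f v + δ * d f v) = ∑ v ∈ U, lam f v + δ * ∑ v, d f v := by
  rw [Finset.sum_add_distrib, ← Finset.mul_sum]
  congr 2
  exact Finset.sum_subset (Finset.subset_univ U) fun v _ hv =>
    hd f v fun he => hv (mem_of_isEdge h he)

theorem acyclic_of_extreme {P : VPCA N Fl} {U : Finset N} {lam : Fl → N → ℝ}
    (hext : lam ∈ Set.extremePoints ℝ (P.Relaxed U)) : (P.fracGraph lam).IsAcyclic := by
  intro x c hc
  have h := hext.1
  have ht := hc.isTrail
  let d : Fl → N → ℝ := fun f v => sign c f v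
  have hd : ∀ f v, ¬ P.IsEdge lam f v → d f v = 0 := fun f v he => sign_eq_zero_of_not_isEdge c he
  have hnode : ∀ v, ∑ f, d f v = 0 := fun v => by rw [sum_sign_flows ht, sub_self]
  have hflow : ∀ f, ∑ v, d f v = 0 := fun f => by rw [sum_sign_nodes ht, sub_self]
  obtain ⟨f, v, hne⟩ : ∃ f v, d f v ≠ 0 := by
    cases c with
    | nil => exact absurd hc SimpleGraph.Walk.not_isCycle_nil
    | @cons _ b _ hab p =>
      obtain ⟨f, v, -, ⟨rfl, rfl⟩ | ⟨rfl, rfl⟩⟩ := P.fracGraph_bipartite lam hab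
      · refine ⟨f, v, ?_⟩
        simp [d, sign]
      · refine ⟨f, v, ?_⟩
        simp only [d, sign, SimpleGraph.Walk.darts_cons, List.mem_cons, exists_eq_or_imp]
        split_ifs <;> simp_all
  have hpos : ∀ f v, lam f v ≤ 0 → d f v = 0 := fun f v hl =>
    hd f v (not_isEdge_iff.2 (.inl hl))
  obtain ⟨ε, hε, hε1, hε2⟩ : ∃ ε : ℝ, 0 < ε ∧ (∀ f u, 0 ≤ lam f u + ε * d f u) ∧
      ∀ f u, 0 ≤ lam f u + ε * -d f u :=
    ((eventually_mem_nhdsWithin (a := (0 : ℝ)) (s := Set.Ioi 0)).and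
      ((Filter.eventually_all.2 fun f => Filter.eventually_all.2 fun u =>
        eventually_nonneg_add_mul (h.1.1 f u) fun hl => (hpos f u hl).ge).and
      (Filter.eventually_all.2 fun f => Filter.eventually_all.2 fun u =>
        eventually_nonneg_add_mul (h.1.1 f u) fun hl => by rw [hpos f u hl, neg_zero]))).exists
  have m1 := add_mem_relaxed h hd hnode hε1 fun f => by
    rw [sum_shift_eq h hd, hflow, mul_zero, add_zero]; exact h.2 f
  have hd' : ∀ f v, ¬ P.IsEdge lam f v → (fun f v => -d f v) f v = 0 := fun f v he => by
    simp only [hd f v he, neg_zero]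
  have m2 := add_mem_relaxed (d := fun f v => -d f v) h hd'
    (fun v => by rw [Finset.sum_neg_distrib, hnode, neg_zero]) hε2 fun f => by
      rw [sum_shift_eq h hd', Finset.sum_neg_distrib, hflow, neg_zero, mul_zero, add_zero]
      exact h.2 f
  have hseg : lam ∈ openSegment ℝ (fun f v => lam f v + ε * d f v)
      (fun f v => lam f v + ε * -d f v) := by
    refine ⟨1 / 2, 1 / 2, by norm_num, by norm_num, by norm_num, ?_⟩
    funext f v
    simp only [Pi.add_apply, Pi.smul_apply, smul_eq_mul]
    ring
  have heq := hext.2 m1 m2 hseg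
  have := congrFun (congrFun heq f) v
  have h0 : ε * d f v = 0 := by linarith
  exact hne ((mul_eq_zero.1 h0).resolve_left hε.ne')

/-! ### Phase I -/

/-- The properties of an assignment that Phase I maintains. -/
structure ForestAssignment (P : VPCA N Fl) (U : Finset N) (lam : Fl → N → ℝ) : Prop where
  relaxed : lam ∈ P.Relaxed U
  off_path : ∀ f, ∀ v, v ∉ P.path f → lam f v = 0
  acyclic : (P.fracGraph lam).IsAcyclic

theorem BasicOptimal.forestAssignment {P : VPCA N Fl} {U : Finset N} {lam : Fl → N → ℝ}
    (h : P.BasicOptimal U lam) : P.ForestAssignment U lam :=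
  ⟨h.1.1, h.2.2, acyclic_of_extreme h.1⟩

theorem ForestAssignment.R1_eq {P : VPCA N Fl} {U : Finset N} {lam : Fl → N → ℝ}
    (h : P.ForestAssignment U lam) : P.R1 U lam = ∑ v, ∑ f, lam f v := by
  rw [Finset.sum_comm, R1]
  refine Finset.sum_congr rfl fun f _ => Finset.sum_subset (Finset.subset_univ _) fun v _ hv => ?_
  by_cases hp : v ∈ P.path f
  · exact h.relaxed.1.2.2 f v fun hU => hv (Finset.mem_inter.2 ⟨hp, hU⟩)
  · exact h.off_path f v hp

theorem add_le_rate_of_ne {P : VPCA N Fl} {U : Finset N} {lam : Fl → N → ℝ}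
    (h : lam ∈ P.Relaxed U) (f : Fl) {u w : N} (hne : u ≠ w) :
    lam f u + lam f w ≤ P.rate f := by
  by_cases hu : u ∈ U
  · by_cases hw : w ∈ U
    · rw [← Finset.sum_pair hne]
      exact (Finset.sum_le_sum_of_subset_of_nonneg (Finset.insert_subset hu
        (Finset.singleton_subset_iff.2 hw)) fun v _ _ => h.1.1 f v).trans (h.2 f)
    · rw [h.1.2.2 f w hw, add_zero]; exact le_rate_of_mem_relaxed h f u
  · rw [h.1.2.2 f u hu, zero_add]; exact le_rate_of_mem_relaxed h f w

theorem eq_zero_of_isEdge_of_not_isEdge {P : VPCA N Fl} {U : Finset N} {lam : Fl → N → ℝ}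
    (h : lam ∈ P.Relaxed U) {f : Fl} {u w : N} (hu : P.IsEdge lam f u)
    (hw : ¬ P.IsEdge lam f w) : lam f w = 0 := by
  have hne : u ≠ w := by rintro rfl; exact hw hu
  have h1 := add_le_rate_of_ne h f hne
  have h2 := (isEdge_iff.1 hu).1
  rcases not_isEdge_iff.1 hw with h3 | h3
  · exact le_antisymm h3 (h.1.1 f w)
  · linarith

open Classical in
/-- The number of fractional values. -/
noncomputable def edgeCount (P : VPCA N Fl) (lam : Fl → N → ℝ) : ℕ :=
  (Finset.univ.filter fun x : Fl × N => P.IsEdge lam x.1 x.2).card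

theorem edgeCount_lt {P : VPCA N Fl} {lam mu : Fl → N → ℝ}
    (h : ∀ f v, P.IsEdge mu f v → P.IsEdge lam f v) {f : Fl} {v : N} (hl : P.IsEdge lam f v)
    (hm : ¬ P.IsEdge mu f v) : P.edgeCount mu < P.edgeCount lam := by
  classical
  refine Finset.card_lt_card (Finset.ssubset_iff_of_subset ?_ |>.2 ⟨(f, v), ?_, ?_⟩)
  · intro x hx
    rw [Finset.mem_filter] at hx ⊢
    exact ⟨hx.1, h _ _ hx.2⟩
  · exact Finset.mem_filter.2 ⟨Finset.mem_univ _, hl⟩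
  · exact fun hc => hm (Finset.mem_filter.1 hc).2

open Classical in
/-- The total load, where the load of the nodes without fractional flows counts twice. -/
noncomputable def potential (P : VPCA N Fl) (lam : Fl → N → ℝ) : ℝ :=
  ∑ v, ∑ f, lam f v + ∑ v, if ∀ f, ¬ P.IsEdge lam f v then ∑ f, lam f v else 0

/-- What a step of Phase I achieves. -/
structure Progress (P : VPCA N Fl) (U : Finset N) (lam mu : Fl → N → ℝ) : Prop where
  forest : P.ForestAssignment U mu
  count_lt : P.edgeCount mu < P.edgeCount lam
  potential_le : P.potential lam ≤ P.potential mu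

theorem fullLoad_eq_of_isSingleton {P : VPCA N Fl} {U : Finset N} {lam : Fl → N → ℝ}
    (h : lam ∈ P.Relaxed U) {v : N} {f : Fl} (hs : P.IsSingleton lam v f) :
    P.fullLoad lam v = ∑ g, if g = f then 0 else lam g v := by
  refine Finset.sum_congr rfl fun g _ => ?_
  by_cases hg : g = f
  · subst hg
    rw [if_neg hs.1.2.ne, if_pos rfl]
  · rw [if_neg hg]
    rcases not_isEdge_iff.1 fun he => hg (hs.2 g he) with h1 | h1
    · have h2 := le_antisymm h1 (h.1.1 g v)
      rw [h2]; split_ifs <;> rfl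
    · have h2 := le_antisymm (le_rate_of_mem_relaxed h g v) h1
      rw [if_pos]
      rw [frac, h2, div_self (P.rate_pos g).ne']

theorem sum_eq_add_sum_ite (x : Fl → ℝ) (f : Fl) :
    ∑ g, x g = x f + ∑ g, if g = f then 0 else x g := by
  rw [← Finset.add_sum_erase _ _ (Finset.mem_univ f)]
  congr 1
  rw [← Finset.add_sum_erase (Finset.univ : Finset Fl) (fun g => if g = f then 0 else x g)
    (Finset.mem_univ f), if_pos rfl, zero_add]
  exact Finset.sum_congr rfl fun g hg => (if_neg (Finset.ne_of_mem_erase hg)).symm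

/-- The load that is lost at a rounded node is at most the load that is kept there. -/
theorem potential_le_of_rounding {P : VPCA N Fl} {U : Finset N} {lam mu : Fl → N → ℝ}
    (hm : mu ∈ P.Relaxed U) {v : N}
    (hv : ∃ f, P.IsEdge lam f v) (hv' : ∀ f, ¬ P.IsEdge mu f v)
    (hsub : ∀ f u, P.IsEdge mu f u → P.IsEdge lam f u)
    (hkeep : ∀ u, u ≠ v → (∀ f, ¬ P.IsEdge lam f u) → ∀ f, lam f u = mu f u)
    (htotal : ∑ u, ∑ f, lam f u ≤ ∑ u, ∑ f, mu f u + ∑ f, mu f v) :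
    P.potential lam ≤ P.potential mu := by
  classical
  have h : (∑ u, if ∀ f, ¬ P.IsEdge lam f u then ∑ f, lam f u else 0) + ∑ f, mu f v ≤
      ∑ u, if ∀ f, ¬ P.IsEdge mu f u then ∑ f, mu f u else 0 := by
    have h1 : ∑ f, mu f v = ∑ u, if u = v then ∑ f, mu f u else 0 := by simp
    rw [h1, ← Finset.sum_add_distrib]
    refine Finset.sum_le_sum fun u _ => ?_
    by_cases huv : u = v
    · subst huv
      obtain ⟨f, hf⟩ := hv
      rw [if_neg fun hc => hc f hf, if_pos rfl, if_pos hv', zero_add]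
    · rw [if_neg huv, add_zero]
      by_cases hi : ∀ f, ¬ P.IsEdge lam f u
      · rw [if_pos hi, if_pos fun f hf => hi f (hsub f u hf)]
        exact (Finset.sum_congr rfl fun f _ => hkeep u huv hi f).le
      · rw [if_neg hi]
        split_ifs
        · exact Finset.sum_nonneg fun f _ => hm.1.1 f u
        · exact le_rfl
  unfold potential
  linarith

theorem progress_drop {P : VPCA N Fl} {U : Finset N} {lam : Fl → N → ℝ}
    (h : P.ForestAssignment U lam) {v : N} {f : Fl} (hs : P.IsSingleton lam v f)
    (hload : lam f v ≤ P.fullLoad lam v) :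
    P.Progress U lam fun g u => if g = f ∧ u = v then 0 else lam g u := by
  set mu : Fl → N → ℝ := fun g u => if g = f ∧ u = v then 0 else lam g u with hmu
  have hmem : mu ∈ P.Relaxed U := by
    refine relaxed_of_le h.relaxed (fun g u => ?_) fun g u => ?_ <;>
    · have := h.relaxed.1.1 g u
      simp only [hmu]; split_ifs <;> linarith
  have hkeep : ∀ g u, ¬ (g = f ∧ u = v) → mu g u = lam g u := fun g u hc => if_neg hc
  have hsub : ∀ g u, P.IsEdge mu g u → P.IsEdge lam g u := by
    intro g u he
    rw [isEdge_iff] at he ⊢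
    by_cases hc : g = f ∧ u = v
    · simp only [hmu, if_pos hc] at he
      exact absurd he.1 (lt_irrefl 0)
    · rwa [hkeep g u hc] at he
  have hiso : ∀ g, ¬ P.IsEdge mu g v := by
    intro g he
    have hg := hs.2 g (hsub g v he)
    have := (isEdge_iff.1 he).1
    simp only [hmu, if_pos (And.intro hg rfl)] at this
    exact lt_irrefl 0 this
  have hloadv : ∑ g, mu g v = P.fullLoad lam v := by
    rw [fullLoad_eq_of_isSingleton h.relaxed hs]
    simp [hmu]
  refine ⟨⟨hmem, fun g u hu => ?_, h.acyclic.anti (fracGraph_mono hsub)⟩,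
    edgeCount_lt hsub hs.1 (hiso f),
    potential_le_of_rounding hmem ⟨f, hs.1⟩ hiso hsub (fun u hu _ g => ?_) ?_⟩
  · simp only [hmu, h.off_path g u hu, ite_self]
  · exact (hkeep g u fun hc => hu hc.2).symm
  · rw [hloadv, ← Finset.add_sum_erase _ _ (Finset.mem_univ v),
      ← Finset.add_sum_erase _ (fun u => ∑ g, mu g u) (Finset.mem_univ v), hloadv,
      sum_eq_add_sum_ite (fun g => lam g v) f, ← fullLoad_eq_of_isSingleton h.relaxed hs]
    have : ∑ u ∈ Finset.univ.erase v, ∑ g, mu g u = ∑ u ∈ Finset.univ.erase v, ∑ g, lam g u :=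
      Finset.sum_congr rfl fun u hu => Finset.sum_congr rfl fun g _ =>
        hkeep g u fun hc => Finset.ne_of_mem_erase hu hc.2
    rw [this]
    linarith

theorem progress_assign {P : VPCA N Fl} {U : Finset N} {lam : Fl → N → ℝ}
    (h : P.ForestAssignment U lam) {v : N} {f : Fl} (hs : P.IsSingleton lam v f)
    (hload : P.fullLoad lam v < lam f v) :
    P.Progress U lam fun g u =>
      if g = f then (if u = v then P.rate f else 0) else if u = v then 0 else lam g u := by
  set mu : Fl → N → ℝ := fun g u =>
    if g = f then (if u = v then P.rate f else 0) else if u = v then 0 else lam g u with hmu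
  have hvU := mem_of_isEdge h.relaxed hs.1
  have hvp : v ∈ P.path f := by
    by_contra hc
    have := (isEdge_iff.1 hs.1).1
    rw [h.off_path f v hc] at this
    exact lt_irrefl 0 this
  have hf : ∀ u, mu f u = if u = v then P.rate f else 0 := fun u => if_pos rfl
  have hle : ∀ g u, g ≠ f → mu g u ≤ lam g u := by
    intro g u hg
    have := h.relaxed.1.1 g u
    simp only [hmu, if_neg hg]; split_ifs <;> linarith
  have hkeep : ∀ g u, g ≠ f → u ≠ v → mu g u = lam g u := fun g u hg hu => by
    simp only [hmu, if_neg hg, if_neg hu]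
  have hgv : ∀ g, g ≠ f → mu g v = 0 := fun g hg => by simp [hmu, hg]
  have hloadv : ∑ g, mu g v = P.rate f := by simp [hmu]
  have hmem : mu ∈ P.Relaxed U := by
    refine ⟨⟨fun g u => ?_, fun u hu => ?_, fun g u hu => ?_⟩, fun g => ?_⟩
    · have h1 := h.relaxed.1.1 g u
      have h2 := (P.rate_pos f).le
      simp only [hmu]; split_ifs <;> linarith
    · by_cases huv : u = v
      · rw [huv, hloadv]; exact P.rate_le_cap f v
      · refine (Finset.sum_le_sum fun g _ => ?_).trans (h.relaxed.1.2.1 u hu)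
        by_cases hg : g = f
        · rw [hg, hf, if_neg huv]; exact h.relaxed.1.1 f u
        · exact hle g u hg
    · have huv : u ≠ v := by rintro rfl; exact hu hvU
      by_cases hg : g = f
      · rw [hg, hf, if_neg huv]
      · rw [hkeep g u hg huv]; exact h.relaxed.1.2.2 g u hu
    · by_cases hg : g = f
      · rw [hg]; simp [hf, hvU]
      · exact (Finset.sum_le_sum fun u _ => hle g u hg).trans (h.relaxed.2 g)
  have hedge : ∀ g u, P.IsEdge mu g u → g ≠ f ∧ u ≠ v := by
    intro g u he
    rw [isEdge_iff] at he
    refine ⟨?_, ?_⟩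
    · rintro rfl
      rw [hf] at he
      split_ifs at he
      · exact lt_irrefl _ he.2
      · exact lt_irrefl _ he.1
    · rintro rfl
      by_cases hg : g = f
      · rw [hg, hf, if_pos rfl] at he
        exact lt_irrefl _ he.2
      · rw [hgv g hg] at he
        exact lt_irrefl _ he.1
  have hsub : ∀ g u, P.IsEdge mu g u → P.IsEdge lam g u := by
    intro g u he
    obtain ⟨hg, hu⟩ := hedge g u he
    rw [isEdge_iff, hkeep g u hg hu, ← isEdge_iff] at he
    exact he
  have hiso : ∀ g, ¬ P.IsEdge mu g v := fun g he => (hedge g v he).2 rfl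
  refine ⟨⟨hmem, fun g u hu => ?_, h.acyclic.anti (fracGraph_mono hsub)⟩,
    edgeCount_lt hsub hs.1 (hiso f),
    potential_le_of_rounding hmem ⟨f, hs.1⟩ hiso hsub (fun u hu hi g => ?_) ?_⟩
  · by_cases hg : g = f
    · subst hg
      rw [hf, if_neg]
      rintro rfl
      exact hu hvp
    · simp only [hmu, if_neg hg, h.off_path g u hu, ite_self]
  · by_cases hg : g = f
    · rw [hg, hf, if_neg hu]
      exact eq_zero_of_isEdge_of_not_isEdge h.relaxed hs.1 (hi f)
    · exact (hkeep g u hg hu).symm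
  · have hfl : ∑ u, lam f u ≤ P.rate f := by
      rw [← Finset.sum_subset (Finset.subset_univ U) fun u _ hu => h.relaxed.1.2.2 f u hu]
      exact h.relaxed.2 f
    have hfm : ∑ u, mu f u = P.rate f := by simp [hf]
    have hg : ∀ g, g ≠ f → ∑ u, lam g u = ∑ u, mu g u + lam g v := by
      intro g hg
      rw [← Finset.add_sum_erase _ _ (Finset.mem_univ v),
        ← Finset.add_sum_erase _ (fun u => mu g u) (Finset.mem_univ v), hgv g hg, zero_add,
        add_comm]
      congr 1
      exact Finset.sum_congr rfl fun u hu => (hkeep g u hg (Finset.ne_of_mem_erase hu)).symm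
    have hg' : (∑ g, if g = f then 0 else ∑ u, lam g u) =
        (∑ g, if g = f then 0 else ∑ u, mu g u) + P.fullLoad lam v := by
      rw [fullLoad_eq_of_isSingleton h.relaxed hs, ← Finset.sum_add_distrib]
      refine Finset.sum_congr rfl fun g _ => ?_
      split_ifs with hgf
      · simp
      · exact hg g hgf
    rw [hloadv, Finset.sum_comm, Finset.sum_comm (f := fun u g => mu g u),
      sum_eq_add_sum_ite (fun g => ∑ u, lam g u) f, sum_eq_add_sum_ite (fun g => ∑ u, mu g u) f,
      hfm, hg']
    have := (isEdge_iff.1 hs.1).2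
    linarith

/-- In the absence of singleton nodes, a longest path ends in a flow of degree one. -/
theorem longestPath_end {P : VPCA N Fl} {lam : Fl → N → ℝ}
    (hac : (P.fracGraph lam).IsAcyclic) (hns : ¬ ∃ v f, P.IsSingleton lam v f) {v : N} {f : Fl}
    {x : Fl ⊕ N} {p : (P.fracGraph lam).Walk (.inr v) x} (hp : P.IsLongestPath lam v f p) :
    ∃ a u, x = .inl a ∧ P.IsEdge lam a u ∧ ∀ w, P.IsEdge lam a w → w = u := by
  obtain ⟨hpath, hsnd, hmax⟩ := hp
  have hnil : ¬ p.Nil := by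
    intro hn
    cases p with
    | nil => simp at hsnd
    | cons h q => exact SimpleGraph.Walk.not_nil_cons hn
  have huniq : ∀ z, (P.fracGraph lam).Adj x z → z = p.penultimate := by
    intro z hz
    refine hac.eq_penultimate_of_adj_end hpath hz ?_
    by_contra hsup
    have h1 := hmax z (p.concat hz) (hpath.concat hsup hz) ?_
    · rw [SimpleGraph.Walk.length_concat] at h1
      omega
    · cases p with
      | nil => exact absurd SimpleGraph.Walk.Nil.nil hnil
      | cons h q =>
        rw [SimpleGraph.Walk.concat_cons, SimpleGraph.Walk.snd_cons]
        rwa [SimpleGraph.Walk.snd_cons] at hsnd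
  have hadj := (p.adj_penultimate hnil).symm
  obtain ⟨a, u, he, ⟨hx, hpen⟩ | ⟨hx, hpen⟩⟩ := P.fracGraph_bipartite lam hadj
  · refine absurd ⟨u, a, he, fun g hg => ?_⟩ hns
    have := huniq (.inl g) (hx ▸ fracGraph_adj_iff.2 hg)
    rw [hpen] at this
    exact Sum.inl_injective this
  · refine ⟨a, u, hx, he, fun w hw => ?_⟩
    have := huniq (.inr w) (hx ▸ (fracGraph_adj_iff.2 hw).symm)
    rw [hpen] at this
    exact Sum.inr_injective this

theorem add_mul_nonneg_of_forall_lt {a s δ : ℝ} (hδ : 0 < δ)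
    (h : ∀ t, 0 ≤ t → t < δ → 0 ≤ a + t * s) : 0 ≤ a + δ * s := by
  have hc : ContinuousAt (fun t : ℝ => a + t * s) δ := by fun_prop
  refine ge_of_tendsto (hc.tendsto.mono_left (nhdsWithin_le_nhds (s := Set.Iio δ))) ?_
  filter_upwards [Ico_mem_nhdsLT hδ] with t ht
  exact h t ht.1 ht.2

theorem progress_shift {P : VPCA N Fl} {U : Finset N} {lam mu : Fl → N → ℝ}
    (h : P.ForestAssignment U lam) (hstep : P.Step2 lam mu) : P.Progress U lam mu := by
  obtain ⟨hns, v, f, g, x, y, p, q, δ, -, -, -, hp, hq, hδ, hbefore, ⟨k, w, hk, hk'⟩, rfl⟩ := hstep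
  obtain ⟨a, ua, rfl, ha, ha'⟩ := longestPath_end h.acyclic hns hp
  obtain ⟨b, ub, rfl, -, -⟩ := longestPath_end h.acyclic hns hq
  have htp := hp.1.isTrail
  have htq := hq.1.isTrail
  let d : Fl → N → ℝ := fun f v => sign p f v - sign q f v
  have hd : ∀ f v, ¬ P.IsEdge lam f v → d f v = 0 := fun f v he => by
    simp only [d, sign_eq_zero_of_not_isEdge p he, sign_eq_zero_of_not_isEdge q he, sub_zero]
  have hnode : ∀ v, ∑ f, d f v = 0 := fun v => by
    simp only [d, Finset.sum_sub_distrib, sum_sign_flows htp, sum_sign_flows htq]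
    simp
  have hflow : ∀ f, ∑ v, d f v = (if a = f then 1 else 0) - if b = f then 1 else 0 := fun f => by
    simp only [d, Finset.sum_sub_distrib, sum_sign_nodes htp, sum_sign_nodes htq]
    simp
  have hmu : perturb lam p q δ = fun f v => lam f v + δ * d f v := rfl
  have hrange : ∀ f v, 0 ≤ lam f v + δ * d f v ∧ lam f v + δ * d f v ≤ P.rate f := by
    intro f v
    by_cases he : P.IsEdge lam f v
    · refine ⟨add_mul_nonneg_of_forall_lt hδ fun t h0 ht =>
        (isEdge_iff.1 (hbefore t h0 ht f v he)).1.le, ?_⟩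
      have := add_mul_nonneg_of_forall_lt (a := P.rate f - lam f v) (s := -d f v) hδ
        fun t h0 ht => by
          have : lam f v + t * d f v < P.rate f := (isEdge_iff.1 (hbefore t h0 ht f v he)).2
          linarith
      linarith
    · rw [hd f v he, mul_zero, add_zero]
      exact ⟨h.relaxed.1.1 f v, le_rate_of_mem_relaxed h.relaxed f v⟩
  have hmem : perturb lam p q δ ∈ P.Relaxed U := by
    rw [hmu]
    refine add_mem_relaxed h.relaxed hd hnode (fun f v => (hrange f v).1) fun f => ?_
    by_cases haf : a = f
    · subst haf
      rw [Finset.sum_eq_single ua]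
      · exact (hrange a ua).2
      · intro u _ hu
        have hne : ¬ P.IsEdge lam a u := fun he => hu (ha' u he)
        rw [hd a u hne, eq_zero_of_isEdge_of_not_isEdge h.relaxed ha hne, mul_zero, add_zero]
      · exact fun hc => absurd (mem_of_isEdge h.relaxed ha) hc
    · rw [sum_shift_eq h.relaxed hd, hflow, if_neg haf]
      have := h.relaxed.2 f
      split_ifs <;> linarith
  have hsame : ∀ f v, ¬ P.IsEdge lam f v → perturb lam p q δ f v = lam f v := fun f v he => by
    rw [hmu]
    simp only [hd f v he, mul_zero, add_zero]
  have hsub : ∀ f v, P.IsEdge (perturb lam p q δ) f v → P.IsEdge lam f v := by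
    intro f v he
    by_contra hc
    refine hc (isEdge_iff.2 ?_)
    rw [isEdge_iff, hsame f v hc] at he
    exact he
  have hload : ∀ v, ∑ f, perturb lam p q δ f v = ∑ f, lam f v := fun v => by
    rw [hmu]
    simp only [Finset.sum_add_distrib, ← Finset.mul_sum, hnode, mul_zero, add_zero]
  refine ⟨⟨hmem, fun f v hv => ?_, h.acyclic.anti (fracGraph_mono hsub)⟩,
    edgeCount_lt hsub hk hk', ?_⟩
  · rw [hsame f v fun he => ?_, h.off_path f v hv]
    have := (isEdge_iff.1 he).1
    rw [h.off_path f v hv] at this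
    exact lt_irrefl 0 this
  · simp only [potential, hload]
    refine add_le_add_right (Finset.sum_le_sum fun u _ => ?_) _
    have h0 : 0 ≤ ∑ f, lam f u := Finset.sum_nonneg fun f _ => h.relaxed.1.1 f u
    by_cases hi : ∀ f, ¬ P.IsEdge lam f u
    · rw [if_pos hi, if_pos fun f hf => hi f (hsub f u hf)]
    · rw [if_neg hi]
      split_ifs
      · exact h0
      · exact le_rfl

theorem progress_of_phaseOneStep {P : VPCA N Fl} {U : Finset N} {lam mu : Fl → N → ℝ}
    (h : P.ForestAssignment U lam) (hstep : P.PhaseOneStep lam mu) : P.Progress U lam mu := by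
  rcases hstep with ⟨v, f, hs, ⟨hl, rfl⟩ | ⟨hl, rfl⟩⟩ | hstep
  · exact progress_drop h hs hl
  · exact progress_assign h hs hl
  · exact progress_shift h hstep

theorem exists_longestPath {P : VPCA N Fl} {lam : Fl → N → ℝ} {v : N} {f : Fl}
    (he : P.IsEdge lam f v) :
    ∃ (x : Fl ⊕ N) (p : (P.fracGraph lam).Walk (.inr v) x), P.IsLongestPath lam v f p := by
  let L : Set ℕ := {n | ∃ (x : Fl ⊕ N) (p : (P.fracGraph lam).Walk (.inr v) x),
    p.IsPath ∧ p.snd = .inl f ∧ p.length = n}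
  have hadj := fracGraph_adj_iff.2 he
  have hne : L.Nonempty := ⟨_, .inl f, .cons hadj .nil, by simp, by simp, rfl⟩
  have hbdd : BddAbove L := by
    refine ⟨Fintype.card (Fl ⊕ N), ?_⟩
    rintro _ ⟨x, p, hp, -, rfl⟩
    exact hp.length_lt.le
  obtain ⟨x, p, hp, hsnd, hlen⟩ := Nat.sSup_mem hne hbdd
  exact ⟨x, p, hp, hsnd, fun y q hq hq' => hlen ▸ le_csSup hbdd ⟨y, q, hq, hq', rfl⟩⟩

theorem sign_first_edge {G : SimpleGraph (Fl ⊕ N)} {v : N} {f : Fl} {x : Fl ⊕ N}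
    {p : G.Walk (.inr v) x} (hsnd : p.snd = .inl f) : sign p f v = 1 := by
  cases p with
  | nil => simp at hsnd
  | cons h q =>
    rw [SimpleGraph.Walk.snd_cons] at hsnd
    subst hsnd
    simp [sign]

theorem sign_other_edge {G : SimpleGraph (Fl ⊕ N)} {v : N} {f g : Fl} (hfg : f ≠ g) {x : Fl ⊕ N}
    {p : G.Walk (.inr v) x} (hp : p.IsPath) (hsnd : p.snd = .inl g) : sign p f v = 0 := by
  cases p with
  | nil => simp at hsnd
  | cons h q =>
    rw [SimpleGraph.Walk.snd_cons] at hsnd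
    subst hsnd
    rw [SimpleGraph.Walk.cons_isPath_iff] at hp
    refine sign_eq_zero fun hc => ?_
    rw [SimpleGraph.Walk.edges_cons, List.mem_cons] at hc
    rcases hc with hc | hc
    · rw [Sym2.congr_right] at hc
      exact hfg (Sum.inl_injective hc)
    · exact hp.2 (q.fst_mem_support_of_mem_edges hc)

theorem exists_step2 {P : VPCA N Fl} {lam : Fl → N → ℝ}
    (hns : ¬ ∃ v f, P.IsSingleton lam v f) {f : Fl} {v : N} (he : P.IsEdge lam f v) :
    ∃ mu, P.Step2 lam mu := by
  obtain ⟨g, hg, hgf⟩ : ∃ g, P.IsEdge lam g v ∧ g ≠ f := by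
    by_contra! hc
    exact hns ⟨v, f, he, hc⟩
  obtain ⟨x, p, hp⟩ := exists_longestPath he
  obtain ⟨y, q, hq⟩ := exists_longestPath hg
  let S : Set ℝ := Set.Ici 0 ∩ ⋃ h, ⋃ u, {t | P.IsEdge lam h u ∧ ¬ P.IsEdge (perturb lam p q t) h u}
  have hS : ∀ t, t ∈ S ↔ 0 ≤ t ∧ ∃ h u, P.IsEdge lam h u ∧ ¬ P.IsEdge (perturb lam p q t) h u :=
    fun t => by simp [S]
  have hclosed : IsClosed S := by
    refine isClosed_Ici.inter (isClosed_iUnion_of_finite fun h => isClosed_iUnion_of_finite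
      fun u => ?_)
    by_cases hhu : P.IsEdge lam h u
    · have : {t | P.IsEdge lam h u ∧ ¬ P.IsEdge (perturb lam p q t) h u} =
          {t | perturb lam p q t h u ≤ 0} ∪ {t | P.rate h ≤ perturb lam p q t h u} := by
        ext t
        simp [hhu, not_isEdge_iff]
      rw [this]
      simp only [perturb]
      exact (isClosed_le (by fun_prop) (by fun_prop)).union
        (isClosed_le (by fun_prop) (by fun_prop))
    · simp [hhu]
  have hne : S.Nonempty := by
    refine ⟨P.rate f, (hS _).2 ⟨(P.rate_pos f).le, f, v, he, not_isEdge_iff.2 (.inr ?_)⟩⟩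
    rw [perturb, sign_first_edge hp.2.1, sign_other_edge hgf.symm hq.1 hq.2.1]
    linarith [(isEdge_iff.1 he).1]
  have hbdd : BddBelow S := ⟨0, fun t ht => ht.1⟩
  have hmem := hclosed.csInf_mem hne hbdd
  have hpos : 0 < sInf S := by
    refine lt_of_le_of_ne hmem.1 fun h0 => ?_
    obtain ⟨-, h, u, h1, h2⟩ := (hS _).1 hmem
    refine h2 (isEdge_iff.2 ?_)
    rw [← h0, perturb, zero_mul, add_zero]
    exact isEdge_iff.1 h1
  refine ⟨_, hns, v, f, g, x, y, p, q, sInf S, hgf.symm, he, hg, hp, hq, hpos, ?_,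
    ((hS _).1 hmem).2, rfl⟩
  intro t h0 ht h u hhu
  by_contra hc
  exact absurd (csInf_le hbdd ((hS t).2 ⟨h0, h, u, hhu, hc⟩)) (not_le.2 ht)

theorem exists_phaseOneStep {P : VPCA N Fl} {lam : Fl → N → ℝ} (h : ¬ P.Rounded lam) :
    ∃ mu, P.PhaseOneStep lam mu := by
  rw [Rounded] at h
  push Not at h
  obtain ⟨f, v, he⟩ := h
  by_cases hs : ∃ v f, P.IsSingleton lam v f
  · obtain ⟨v, f, hs⟩ := hs
    rcases le_or_gt (lam f v) (P.fullLoad lam v) with hl | hl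
    · exact ⟨_, .inl ⟨v, f, hs, .inl ⟨hl, rfl⟩⟩⟩
    · exact ⟨_, .inl ⟨v, f, hs, .inr ⟨hl, rfl⟩⟩⟩
  · obtain ⟨mu, hmu⟩ := exists_step2 hs he
    exact ⟨mu, .inr hmu⟩

theorem phaseOne_alwaysEnds {P : VPCA N Fl} {U : Finset N} {lam : Fl → N → ℝ}
    (h : P.ForestAssignment U lam) : AlwaysEnds P.PhaseOneStep P.Rounded lam := by
  induction hn : P.edgeCount lam using Nat.strong_induction_on generalizing lam with
  | _ n ih =>
    by_cases hr : P.Rounded lam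
    · exact .finish _ hr
    · refine .next _ (exists_phaseOneStep hr) fun mu hmu => ?_
      have hp := progress_of_phaseOneStep h hmu
      exact ih _ (hn ▸ hp.count_lt) hp.forest rfl

theorem forest_and_potential_of_phaseOne {P : VPCA N Fl} {U : Finset N} {lam mu : Fl → N → ℝ}
    (h : P.ForestAssignment U lam) (hrun : Relation.ReflTransGen P.PhaseOneStep lam mu) :
    P.ForestAssignment U mu ∧ P.potential lam ≤ P.potential mu := by
  induction hrun with
  | refl => exact ⟨h, le_rfl⟩
  | tail _ hstep ih =>
    have hp := progress_of_phaseOneStep ih.1 hstep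
    exact ⟨hp.forest, ih.2.trans hp.potential_le⟩

theorem R1_le_J1_of_rounded {P : VPCA N Fl} {U : Finset N} {lam : Fl → N → ℝ}
    (h : lam ∈ P.Relaxed U) (hr : P.Rounded lam) : P.R1 U lam ≤ P.J1 U lam := by
  refine Finset.sum_le_sum fun f _ => ?_
  split_ifs with hf
  · exact (Finset.sum_le_sum_of_subset_of_nonneg Finset.inter_subset_right
      fun v _ _ => h.1.1 f v).trans (h.2 f)
  · refine (Finset.sum_nonpos fun v hv => ?_)
    refine (not_isEdge_iff.1 (hr f v)).resolve_right fun hc => hf ?_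
    exact hc.trans (Finset.single_le_sum (f := fun v => lam f v) (fun u _ => h.1.1 f u) hv)

theorem phaseOne_bound {P : VPCA N Fl} {U : Finset N} {lam mu : Fl → N → ℝ}
    (h : P.BasicOptimal U lam) (hrun : RunsTo P.PhaseOneStep P.Rounded lam mu) :
    mu ∈ P.Relaxed U ∧ 1 / 2 * P.R3 U ≤ P.J1 U mu := by
  have hl := h.forestAssignment
  obtain ⟨hm, hpot⟩ := forest_and_potential_of_phaseOne hl hrun.1
  refine ⟨hm.relaxed, ?_⟩
  have h1 : P.R3 U ≤ P.potential lam := by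
    rw [← h.2.1, hl.R1_eq, potential]
    refine le_add_of_nonneg_right (Finset.sum_nonneg fun v _ => ?_)
    split_ifs
    · exact Finset.sum_nonneg fun f _ => hl.relaxed.1.1 f v
    · exact le_rfl
  have h2 : P.potential mu = 2 * P.R1 U mu := by
    rw [hm.R1_eq, potential, two_mul]
    congr 1
    exact Finset.sum_congr rfl fun v _ => if_pos fun f => hrun.2 f v
  have h3 := R1_le_J1_of_rounded hm.relaxed hrun.2
  linarith

/-! ### Phase II -/

theorem capacityOK_of_phaseTwoStep {P : VPCA N Fl} {U : Finset N} {lam mu : Fl → N → ℝ}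
    (h : P.CapacityOK U lam) (hstep : P.PhaseTwoStep U lam mu) : P.CapacityOK U mu := by
  obtain ⟨f, x, -, hx0, hxc, hxz, -, rfl⟩ := hstep
  have hne : ∀ g v, g ≠ f → Function.update lam f x g v = lam g v := fun g v hg => by
    rw [Function.update_of_ne hg]
  have heq : ∀ v, Function.update lam f x f v = x v := fun v => by rw [Function.update_self]
  refine ⟨fun g v => ?_, fun v hv => ?_, fun g v hv => ?_⟩
  · by_cases hg : g = f
    · rw [hg, heq]; exact hx0 v
    · rw [hne g v hg]; exact h.1 g v
  · have hxv : x v ≤ P.remCap lam v := by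
      by_cases hp : v ∈ P.path f ∩ U
      · exact hxc v hp
      · rw [hxz v hp]
        exact sub_nonneg.2 (h.2.1 v hv)
    have h1 : (∑ g, if g = f then 0 else Function.update lam f x g v) =
        ∑ g, if g = f then 0 else lam g v :=
      Finset.sum_congr rfl fun g _ => by
        split_ifs with hg
        · rfl
        · exact hne g v hg
    rw [remCap, sum_eq_add_sum_ite (fun g => lam g v) f] at hxv
    rw [sum_eq_add_sum_ite (fun g => Function.update lam f x g v) f, heq, h1]
    linarith [h.1 f v]
  · by_cases hg : g = f
    · rw [hg, heq]; exact hxz v fun hc => hv (Finset.mem_inter.1 hc).2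
    · rw [hne g v hg]; exact h.2.2 g v hv

theorem processed_of_phaseTwoStep {P : VPCA N Fl} {U : Finset N} {lam mu : Fl → N → ℝ}
    (hstep : P.PhaseTwoStep U lam mu) :
    (∀ g, P.Processed U lam g → P.Processed U mu g) ∧
      ∃ f, ¬ P.Processed U lam f ∧ P.Processed U mu f := by
  obtain ⟨f, x, ⟨-, hf, -⟩, -, -, hxz, hxs, rfl⟩ := hstep
  have hnew : P.Processed U (Function.update lam f x) f := by
    rw [Processed, Function.update_self, Finset.sum_subset (Finset.subset_univ (P.path f ∩ U))
      fun v _ hv => hxz v hv, hxs]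
  refine ⟨fun g hg => ?_, f, hf, hnew⟩
  by_cases hgf : g = f
  · rw [hgf]; exact hnew
  · rw [Processed, Function.update_of_ne hgf]; exact hg

theorem J1_mono {P : VPCA N Fl} {U : Finset N} {lam mu : Fl → N → ℝ}
    (h : ∀ g, P.Processed U lam g → P.Processed U mu g) : P.J1 U lam ≤ P.J1 U mu := by
  refine Finset.sum_le_sum fun f _ => ?_
  have := (P.rate_pos f).le
  split_ifs with h1 h2 h2
  · exact le_rfl
  · exact absurd (h f h1) h2
  · exact this
  · exact le_rfl

theorem exists_phaseTwoStep {P : VPCA N Fl} {U : Finset N} {lam : Fl → N → ℝ}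
    (h : P.CapacityOK U lam) (hd : ¬ P.PhaseTwoDone U lam) : ∃ mu, P.PhaseTwoStep U lam mu := by
  rw [PhaseTwoDone] at hd
  push Not at hd
  obtain ⟨f, hf⟩ := hd
  have hrem : ∀ v ∈ P.path f ∩ U, 0 ≤ P.remCap lam v := fun v hv =>
    sub_nonneg.2 (h.2.1 v (Finset.mem_inter.1 hv).2)
  have hr := P.rate_pos f
  have hpos := hr.trans_le hf.2.2
  set R := ∑ v ∈ P.path f ∩ U, P.remCap lam v
  have hle : P.rate f / R ≤ 1 := (div_le_one hpos).2 hf.2.2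
  refine ⟨_, f, fun v => if v ∈ P.path f ∩ U then P.rate f / R * P.remCap lam v else 0, hf,
    fun v => ?_, fun v hv => ?_, fun v hv => if_neg hv, ?_, rfl⟩
  · beta_reduce
    split_ifs with hv
    · exact mul_nonneg (div_nonneg hr.le hpos.le) (hrem v hv)
    · exact le_rfl
  · beta_reduce
    rw [if_pos hv]
    exact mul_le_of_le_one_left (hrem v hv) hle
  · rw [Finset.sum_ite_mem, Finset.univ_inter, ← Finset.mul_sum]
    exact div_mul_cancel₀ _ hpos.ne'

theorem phaseTwo_alwaysEnds {P : VPCA N Fl} {U : Finset N} {lam : Fl → N → ℝ}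
    (h : P.CapacityOK U lam) : AlwaysEnds (P.PhaseTwoStep U) (P.PhaseTwoDone U) lam := by
  classical
  induction hn : (Finset.univ.filter fun f => ¬ P.Processed U lam f).card using
    Nat.strong_induction_on generalizing lam with
  | _ n ih =>
    by_cases hd : P.PhaseTwoDone U lam
    · exact .finish _ hd
    · refine .next _ (exists_phaseTwoStep h hd) fun mu hmu =>
        ih _ ?_ (capacityOK_of_phaseTwoStep h hmu) rfl
      obtain ⟨hmono, f, hf, hf'⟩ := processed_of_phaseTwoStep hmu
      rw [← hn]
      refine Finset.card_lt_card (Finset.ssubset_iff_of_subset ?_ |>.2 ⟨f, ?_, ?_⟩)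
      · intro g hg
        rw [Finset.mem_filter] at hg ⊢
        exact ⟨hg.1, fun hc => hg.2 (hmono g hc)⟩
      · exact Finset.mem_filter.2 ⟨Finset.mem_univ f, hf⟩
      · exact fun hc => (Finset.mem_filter.1 hc).2 hf'

theorem phaseTwo_bound {P : VPCA N Fl} {U : Finset N} {lam mu : Fl → N → ℝ}
    (h : P.CapacityOK U lam) (hrun : Relation.ReflTransGen (P.PhaseTwoStep U) lam mu) :
    P.CapacityOK U mu ∧ P.J1 U lam ≤ P.J1 U mu := by
  induction hrun with
  | refl => exact ⟨h, le_rfl⟩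
  | tail _ hstep ih =>
    exact ⟨capacityOK_of_phaseTwoStep ih.1 hstep,
      ih.2.trans (J1_mono (processed_of_phaseTwoStep hstep).1)⟩

/-! ### The approximation ratio -/

theorem RPMCAOutput.feasible_and_bound {P : VPCA N Fl} {U : Finset N} {lam : Fl → N → ℝ}
    (h : P.RPMCAOutput U lam) : P.Feasible U lam ∧ ∀ U' lam', P.Feasible U' lam' →
      (1 / 2) * (1 - 1 / Real.exp 1) * P.J1 U' lam' ≤ P.J1 U lam := by
  obtain ⟨hU, lam₀, lam₁, h0, h1, h2⟩ := h
  have haff : P.Affordable U := hU.elim SGOutput.affordable EGOutput.affordable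
  obtain ⟨hrel, hJ1⟩ := phaseOne_bound h0 h1
  obtain ⟨hcap, hJ2⟩ := phaseTwo_bound hrel.1 h2.1
  refine ⟨⟨haff, hcap⟩, fun U' lam' hf => ?_⟩
  have hR : (1 - 1 / Real.exp 1) * P.R3 U' ≤ P.R3 U :=
    hU.elim (fun h => h.bound hf.1) fun h => h.bound hf.1
  have he : 0 ≤ 1 - 1 / Real.exp 1 :=
    sub_nonneg.2 ((div_le_one (Real.exp_pos 1)).2 (Real.one_le_exp zero_le_one))
  have := mul_le_mul_of_nonneg_left (J1_le_R3 hf.2) he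
  linarith

end

end VPCA

theorem theorem3 {N Fl : Type*} [Fintype N] [DecidableEq N] [Fintype Fl] [DecidableEq Fl]
    (P : VPCA N Fl) :
    -- the algorithm can be carried out, and it halts whatever choices are made
    (∃ U, P.EGOutput U) ∧
    ((∃ b, ∀ v, P.cost v = b) → ∃ U, P.SGOutput U) ∧
    (∀ U, P.SGOutput U ∨ P.EGOutput U →
      (∃ lam, P.BasicOptimal U lam) ∧
      ∀ lam₀, P.BasicOptimal U lam₀ →
        VPCA.AlwaysEnds P.PhaseOneStep P.Rounded lam₀ ∧
        ∀ lam₁, VPCA.RunsTo P.PhaseOneStep P.Rounded lam₀ lam₁ →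
          VPCA.AlwaysEnds (P.PhaseTwoStep U) (P.PhaseTwoDone U) lam₁) ∧
    -- every output is feasible and within the factor of every feasible solution
    (∀ U lam, P.RPMCAOutput U lam →
      P.Feasible U lam ∧
      ∀ U' lam', P.Feasible U' lam' →
        (1 / 2) * (1 - 1 / Real.exp 1) * P.J1 U' lam' ≤ P.J1 U lam) := by
  exact ⟨P.exists_egOutput, P.exists_sgOutput, fun U _ => ⟨P.exists_basicOptimal U, fun lam₀ h₀ =>
    ⟨VPCA.phaseOne_alwaysEnds h₀.forestAssignment, fun lam₁ h₁ =>
      VPCA.phaseTwo_alwaysEnds (VPCA.phaseOne_bound h₀ h₁).1.1⟩⟩,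
    fun U lam h => h.feasible_and_bound⟩
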